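/- Let $\mathbb{K}$ be an algebraically closed field of characteristic $0$, and let $d, s, m$ be integers with $0\le s\le m-1$ and $d\ge m$. Let $\nu_d:\mathbb{P}^m\to\mathbb{P}^r$, $r=\binom{m+d}{m}-1$, be the Veronese embedding given by all forms of degree $d$, and let $\langle\ \rangle$ denote linear span. For $P\in\mathbb{P}^r$ let the rank $r_{m,d}(P)$ be the minimal cardinality of a finite set $B\subset\mathbb{P}^m$ with $P\in\langle\nu_d(B)\rangle$, and let $\mathcal{S}(P)$ be the set of all $B\subset\mathbb{P}^m$ with $\sharp(B)=r_{m,d}(P)$ and $P\in\langle\nu_d(B)\rangle$. Let $A_1\subset\mathbb{P}^m$ be a connected zero-dimensional scheme of degree $2$, with reduction $\{O\}$, and let $S\subset\mathbb{P}^m$ be a set of $s$ points with $S\cap A_1=\emptyset$, such that the scheme $A:=A_1\cup S$ is linearly independent, i.e. $\dim\langle A\rangle=\deg(A)-1$. Let $P\in\langle\nu_d(A)\rangle$ be such that $P\notin\langle\nu_d(A')\rangle$ for every closed subscheme $A'\subsetneq A$. Then $r_{m,d}(P)=s+d$. Moreover, if $(d,s)\ne(2,1)$, then every $B\in\mathcal{S}(P)$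 is the disjoint union of $S$ and $d$ points of $\langle A_1\rangle\setminus\{O\}$. -/

import Mathlib

open scoped LinearAlgebra.Projectivization

noncomputable section

variable {K : Type*} [Field K] {m : ℕ}

/-- Evaluation of a form of degree `n` is homogeneous of degree `n`. -/
theorem MvPolynomial.IsHomogeneous.eval_smul_vec {σ : Type*} {f : MvPolynomial σ K} {n : ℕ}
    (hf : f.IsHomogeneous n) (c : K) (v : σ → K) :
    MvPolynomial.eval (c • v) f = c ^ n * MvPolynomial.eval v f := by
  rw [MvPolynomial.eval_eq, MvPolynomial.eval_eq, Finset.mul_sum]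
  refine Finset.sum_congr rfl fun α hα => ?_
  have hdeg : ∑ i ∈ α.support, α i = n := by
    rw [← hf (MvPolynomial.mem_support_iff.mp hα), Finsupp.weight_apply]
    simp [Finsupp.sum]
  simp only [Pi.smul_apply, smul_eq_mul, mul_pow, Finset.prod_mul_distrib,
    Finset.prod_pow_eq_pow_sum, hdeg]
  ring

/-- The polynomial `f` vanishes at the point `p` of `ℙ^m`, i.e. on all the nonzero vectors
of the line `p`. -/
def VanishesAt (f : MvPolynomial (Fin (m + 1)) K) (p : ℙ K (Fin (m + 1) → K)) : Prop :=
  ∀ (v : Fin (m + 1) → K) (hv : v ≠ 0), Projectivization.mk K v hv = p →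
    MvPolynomial.eval v f = 0

/-- Over an infinite field, all homogeneous components of a polynomial that vanishes at a
point of `ℙ^m` vanish there. -/
theorem VanishesAt.homogeneousComponent [Infinite K] {f : MvPolynomial (Fin (m + 1)) K}
    {p : ℙ K (Fin (m + 1) → K)} (h : VanishesAt f p) (n : ℕ) :
    VanishesAt (MvPolynomial.homogeneousComponent n f) p := by
  intro v hv hp
  let q : Polynomial K := ∑ i ∈ Finset.range (f.totalDegree + 1),
    Polynomial.C (MvPolynomial.eval v (MvPolynomial.homogeneousComponent i f)) * Polynomial.X ^ i
  have key : ∀ t : K, t ≠ 0 → q.eval t = 0 := by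
    intro t ht
    have htv : t • v ≠ 0 := smul_ne_zero ht hv
    have h0 := h (t • v) htv (by
      rw [← hp, Projectivization.mk_eq_mk_iff']
      exact ⟨t, rfl⟩)
    rw [← MvPolynomial.sum_homogeneousComponent f, map_sum] at h0
    rw [← h0, Polynomial.eval_finsetSum]
    refine Finset.sum_congr rfl fun i _ => ?_
    rw [(MvPolynomial.homogeneousComponent_isHomogeneous i f).eval_smul_vec]
    rw [Polynomial.eval_mul, Polynomial.eval_C, Polynomial.eval_pow, Polynomial.eval_X, mul_comm]
  have hq : q = 0 := by
    refine Polynomial.eq_zero_of_infinite_isRoot q ?_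
    refine Set.Infinite.mono (s := {0}ᶜ) (fun t ht => key t ht) ?_
    exact (Set.finite_singleton (0 : K)).infinite_compl
  by_cases hn : n ∈ Finset.range (f.totalDegree + 1)
  · have := congrArg (fun r => Polynomial.coeff r n) hq
    simpa [q, Polynomial.finsetSum_coeff, Polynomial.coeff_C_mul, Polynomial.coeff_X_pow,
      hn, Nat.lt_succ_iff.mp (Finset.mem_range.mp hn)] using this
  · rw [MvPolynomial.homogeneousComponent_eq_zero n f (by simpa using hn), map_zero]

variable (K m) in
/-- A closed subscheme of `ℙ^m` over `K`, given by its saturated homogeneous ideal in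
`K[x_0, …, x_m]`.  (Closed subschemes of `ℙ^m` correspond bijectively, reversing inclusions,
to the saturated homogeneous ideals; `ideal = ⊤` is the empty scheme.) -/
@[ext]
structure ProjSubscheme where
  ideal : Ideal (MvPolynomial (Fin (m + 1)) K)
  homogeneous : ∀ f ∈ ideal, ∀ n : ℕ, MvPolynomial.homogeneousComponent n f ∈ ideal
  saturated : ∀ f, (∀ i, MvPolynomial.X i * f ∈ ideal) → f ∈ ideal

namespace ProjSubscheme

/-- Inclusion `A ⊆ B` of closed subschemes: reverse inclusion of saturated ideals. -/
instance : PartialOrder (ProjSubscheme K m) where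
  le A B := B.ideal ≤ A.ideal
  le_refl A := le_refl A.ideal
  le_trans _ _ _ hAB hBC := le_trans hBC hAB
  le_antisymm _ _ hAB hBA := ProjSubscheme.ext (le_antisymm hBA hAB)

/-- The scheme-theoretic union of two closed subschemes (intersection of the ideals). -/
def union (A B : ProjSubscheme K m) : ProjSubscheme K m where
  ideal := A.ideal ⊓ B.ideal
  homogeneous f hf n := ⟨A.homogeneous f hf.1 n, B.homogeneous f hf.2 n⟩
  saturated f hf := ⟨A.saturated f fun i => (hf i).1, B.saturated f fun i => (hf i).2⟩

/-- A finite set of points of `ℙ^m`, as a reduced closed subscheme. -/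
def ofFinset [Infinite K] (S : Finset (ℙ K (Fin (m + 1) → K))) : ProjSubscheme K m where
  ideal :=
    { carrier := {f | ∀ p ∈ S, VanishesAt f p}
      zero_mem' := fun p _ v hv _ => map_zero _
      add_mem' := fun {f g} hf hg p hp v hv h => by
        rw [map_add, hf p hp v hv h, hg p hp v hv h, add_zero]
      smul_mem' := fun c f hf p hp v hv h => by
        rw [smul_eq_mul, map_mul, hf p hp v hv h, mul_zero] }
  homogeneous f hf n p hp := (hf p hp).homogeneousComponent n
  saturated f hf p hp v hv h := by
    obtain ⟨i, hi⟩ := Function.ne_iff.mp hv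
    have h1 := hf i p hp v hv h
    rw [map_mul, MvPolynomial.eval_X] at h1
    exact (mul_eq_zero.mp h1).resolve_left hi

/-- The set of (closed) points of the scheme `A`; for `K` algebraically closed this is the
underlying reduced scheme `A_red`. -/
def support (A : ProjSubscheme K m) : Set (ℙ K (Fin (m + 1) → K)) :=
  {p | ∀ f ∈ A.ideal, VanishesAt f p}

/-- The forms of degree `n` that vanish on the scheme `A`: `H⁰(ℙ^m, 𝓘_A(n))`. -/
def formsThrough (A : ProjSubscheme K m) (n : ℕ) :
    Submodule K (MvPolynomial.homogeneousSubmodule (Fin (m + 1)) K n) :=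
  (A.ideal.restrictScalars K).comap
    (MvPolynomial.homogeneousSubmodule (Fin (m + 1)) K n).subtype

/-- `A` is zero-dimensional of degree `e` (or empty, with `e = 0`): its Hilbert polynomial is
the constant `e`, i.e. `dim (K[x_0, …, x_m] / I_A)_n = e` for all large `n`. -/
def HasDegree (A : ProjSubscheme K m) (e : ℕ) : Prop :=
  ∀ᶠ n in Filter.atTop,
    Module.finrank K (MvPolynomial.homogeneousSubmodule (Fin (m + 1)) K n ⧸ A.formsThrough n) = e

/-- The linear span `⟨A⟩ ⊆ ℙ^m`, as a vector subspace of `K^(m+1)`: the intersection of the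
hyperplanes `a_0 x_0 + ⋯ + a_m x_m = 0` that contain the scheme `A`. -/
def linearSpan (A : ProjSubscheme K m) : Submodule K (Fin (m + 1) → K) where
  carrier := {v | ∀ a : Fin (m + 1) → K,
    ∑ i, MvPolynomial.C (a i) * MvPolynomial.X i ∈ A.ideal → a ⬝ᵥ v = 0}
  zero_mem' := fun a _ => dotProduct_zero a
  add_mem' := fun {v w} hv hw a ha => by rw [dotProduct_add, hv a ha, hw a ha, add_zero]
  smul_mem' := fun c v hv a ha => by rw [dotProduct_smul, hv a ha, smul_zero]

/-- A zero-dimensional scheme `A` is linearly independent if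
`dim ⟨A⟩ = deg A - 1`, with `dim ⟨A⟩` the projective dimension. -/
def IsLinearlyIndependent (A : ProjSubscheme K m) : Prop :=
  A.HasDegree (Module.finrank K A.linearSpan)

end ProjSubscheme

variable (K m) in
/-- The vector space `(K[x_0, …, x_m]_d)^*`.  Its projectivization is the target `ℙ^r`,
`r = binom(m+d, m) - 1`, of the `d`-th Veronese embedding; the hyperplanes of `ℙ^r` are the
nonzero forms of degree `d` up to scalars. -/
abbrev VeroneseSpace (d : ℕ) : Type _ :=
  Module.Dual K (MvPolynomial.homogeneousSubmodule (Fin (m + 1)) K d)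

/-- Evaluation at `v` of the forms of degree `d`. -/
def evalForms (d : ℕ) (v : Fin (m + 1) → K) : VeroneseSpace K m d :=
  (MvPolynomial.aeval v).toLinearMap ∘ₗ (MvPolynomial.homogeneousSubmodule (Fin (m + 1)) K d).subtype

theorem evalForms_apply (d : ℕ) (v : Fin (m + 1) → K)
    (f : MvPolynomial.homogeneousSubmodule (Fin (m + 1)) K d) :
    evalForms d v f = MvPolynomial.eval v (f : MvPolynomial (Fin (m + 1)) K) := by
  simp [evalForms, MvPolynomial.aeval_eq_eval]

theorem evalForms_ne_zero (d : ℕ) {v : Fin (m + 1) → K} (hv : v ≠ 0) : evalForms d v ≠ 0 := by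
  obtain ⟨i, hi⟩ := Function.ne_iff.mp hv
  intro h
  have h1 := evalForms_apply d v ⟨MvPolynomial.X i ^ d, by
    simpa using (MvPolynomial.isHomogeneous_X K i).pow d⟩
  rw [h] at h1
  simp only [LinearMap.zero_apply, map_pow, MvPolynomial.eval_X] at h1
  exact pow_ne_zero d hi h1.symm

/-- The Veronese embedding `ν_d : ℙ^m → ℙ^r` given by all forms of degree `d`, which sends
`[v]` to the class of the evaluation functional `f ↦ f(v)`. -/
def veronese (d : ℕ) : ℙ K (Fin (m + 1) → K) → ℙ K (VeroneseSpace K m d) :=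
  Projectivization.lift
    (fun v => Projectivization.mk K (evalForms d v.1) (evalForms_ne_zero d v.2))
    (by
      intro v w t h
      rw [Projectivization.mk_eq_mk_iff']
      refine ⟨t ^ d, ?_⟩
      ext f
      rw [LinearMap.smul_apply, evalForms_apply, evalForms_apply, h,
        MvPolynomial.IsHomogeneous.eval_smul_vec
          ((MvPolynomial.mem_homogeneousSubmodule d _).mp f.2), smul_eq_mul])

/-- The linear span `⟨ν_d(A)⟩ ⊆ ℙ^r` of the scheme `ν_d(A)`: the intersection of all the
hyperplanes of `ℙ^r` containing `ν_d(A)`.  The hyperplane of `ℙ^r` given by a form `f` of degree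
`d` contains `ν_d(A)` exactly when `f` lies in the ideal of `A`. -/
def ProjSubscheme.veroneseSpan (A : ProjSubscheme K m) (d : ℕ) :
    Projectivization.Subspace K (VeroneseSpace K m d) :=
  (A.formsThrough d).dualAnnihilator.projectivization

/-- `P ∈ ⟨ν_d(B)⟩` for a finite set `B` of points of `ℙ^m`. -/
def InVeroneseSpan {d : ℕ} (P : ℙ K (VeroneseSpace K m d))
    (B : Finset (ℙ K (Fin (m + 1) → K))) : Prop :=
  P ∈ Projectivization.Subspace.span (veronese d '' (B : Set (ℙ K (Fin (m + 1) → K))))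

/-- The (symmetric tensor) rank `r_{m,d}(P)`: the minimal cardinality of a set `B ⊆ ℙ^m` with
`P ∈ ⟨ν_d(B)⟩`. -/
def symRank {d : ℕ} (P : ℙ K (VeroneseSpace K m d)) : ℕ :=
  sInf {n | ∃ B : Finset (ℙ K (Fin (m + 1) → K)), B.card = n ∧ InVeroneseSpan P B}

/-- `𝓢(P)`: the sets `B ⊆ ℙ^m` that evince the rank of `P`. -/
def rankSets {d : ℕ} (P : ℙ K (VeroneseSpace K m d)) :
    Set (Finset (ℙ K (Fin (m + 1) → K))) :=
  {B | InVeroneseSpan P B ∧ B.card = symRank P}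

end

/-! By the Nullstellensatz and saturation, `A₁` is a tangent vector: a form lies in its ideal
exactly when its value at `O` and its derivative at `O` along some `u` vanish
(`HasDegree.exists_tangent`). Hence `P` is a functional `b·∂_u|_O + a·ev_O + Σ c_p·ev_p` on forms of
degree `d`, and minimality forces `b ≠ 0` and every `c_p ≠ 0`. Linear independence of `A` says that
`O`, `u` and `S` are represented by independent vectors.

Upper bound: restricted to the line `t ↦ tO + u`, a form is a polynomial whose two leading
coefficients are its value and its derivative at `O`. If it vanishes at `d` distinct parameters with
sum `a/b`, Vieta kills `b·∂_u + a·ev_O`; so these `d` points together with `S` span `P`.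

Lower bound: a decomposition of `P` over `B` is an identity of functionals, a `TangentRelation`.
Cancel the evaluations common to both sides. The derivative survives, some subset `S'` of `S`
remains on the left, and on the right a set `T` avoiding `O` and `S`. Multiplication by a linear
form vanishing at a point of `T`, but not at `O` or on `S'`, lowers the degree by one and removes at
least one point of `T`. In degree two the points of `T` must span the whole left-hand frame, so `|T|
≥ |S'| + d` (`card_add_le`). The cancelled points of `S` lie in `B`, whence `|B| ≥ |S| + d`.

Equality: if `S'` is nonempty and `d ≥ 3`, equality would make every line through two points of `T`
meet `S' ∪ {O}`, and an independent subset of `T` has too many such lines (`card_add_lt`). So `S'`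
is empty, `S ⊆ B`, and separating forms put the `d` remaining points on the tangent line. Since `d ≥
|S| + 1`, degree two with `S'` nonempty occurs only in the excluded case. -/

noncomputable section

open MvPolynomial

/-! ### Linear forms, directional derivatives and hyperplanes. -/

section Forms

variable {K : Type*} [Field K] {m : ℕ}

/-- The linear form with coefficient vector `a`. -/
def linearForm (a : Fin (m + 1) → K) : MvPolynomial (Fin (m + 1)) K :=
  ∑ i, C (a i) * X i

theorem eval_linearForm (a v : Fin (m + 1) → K) : eval v (linearForm a) = a ⬝ᵥ v := by
  simp [linearForm, dotProduct]

theorem isHomogeneous_linearForm (a : Fin (m + 1) → K) : (linearForm a).IsHomogeneous 1 :=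
  IsHomogeneous.sum _ _ _ fun i _ => isHomogeneous_C_mul_X (a i) i

theorem linearForm_add (a b : Fin (m + 1) → K) :
    linearForm (a + b) = linearForm a + linearForm b := by
  simp [linearForm, add_mul, Finset.sum_add_distrib]

theorem linearForm_smul (c : K) (a : Fin (m + 1) → K) :
    linearForm (c • a) = C c * linearForm a := by
  simp [linearForm, Finset.mul_sum, mul_assoc]

theorem linearForm_single (i : Fin (m + 1)) :
    linearForm (Pi.single i (1 : K)) = X i := by
  classical
  simp only [linearForm]
  rw [Finset.sum_eq_single i]
  · simp
  · intro j _ hj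
    simp [Pi.single_eq_of_ne hj]
  · simp

/-- Every form of degree one is `linearForm a` for some `a`. -/
theorem MvPolynomial.IsHomogeneous.exists_eq_linearForm {f : MvPolynomial (Fin (m + 1)) K}
    (hf : f.IsHomogeneous 1) : ∃ a : Fin (m + 1) → K, f = linearForm a := by
  have h : f ∈ homogeneousSubmodule (Fin (m + 1)) K 1 := hf
  rw [homogeneousSubmodule_one_eq_span_X] at h
  induction h using Submodule.span_induction with
  | mem x hx =>
    obtain ⟨i, rfl⟩ := hx
    exact ⟨_, (linearForm_single i).symm⟩
  | zero => exact ⟨0, by simp [linearForm]⟩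
  | add x y hx hy ihx ihy =>
    obtain ⟨a, rfl⟩ := ihx (by rw [← mem_homogeneousSubmodule, homogeneousSubmodule_one_eq_span_X]; exact hx)
    obtain ⟨b, rfl⟩ := ihy (by rw [← mem_homogeneousSubmodule, homogeneousSubmodule_one_eq_span_X]; exact hy)
    exact ⟨a + b, (linearForm_add a b).symm⟩
  | smul c x hx ih =>
    obtain ⟨a, rfl⟩ := ih (by rw [← mem_homogeneousSubmodule, homogeneousSubmodule_one_eq_span_X]; exact hx)
    exact ⟨c • a, by rw [linearForm_smul, smul_eq_C_mul]⟩

/-- The derivative at `o` in the direction `u`. -/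
def dirDeriv (o u : Fin (m + 1) → K) : MvPolynomial (Fin (m + 1)) K →ₗ[K] K :=
  ∑ i, u i • ((aeval o).toLinearMap ∘ₗ (pderiv i).toLinearMap)

theorem dirDeriv_apply (o u : Fin (m + 1) → K) (f : MvPolynomial (Fin (m + 1)) K) :
    dirDeriv o u f = ∑ i, u i * eval o (pderiv i f) := by
  simp [dirDeriv, aeval_eq_eval]

theorem dirDeriv_mul (o u : Fin (m + 1) → K) (f g : MvPolynomial (Fin (m + 1)) K) :
    dirDeriv o u (f * g) = eval o f * dirDeriv o u g + eval o g * dirDeriv o u f := by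
  simp only [dirDeriv_apply, Derivation.leibniz, smul_eq_mul, map_add, map_mul, mul_add,
    Finset.sum_add_distrib, Finset.mul_sum]
  congr 1 <;> exact Finset.sum_congr rfl fun i _ => by ring

theorem dirDeriv_C (o u : Fin (m + 1) → K) (c : K) : dirDeriv o u (C c) = 0 := by
  simp [dirDeriv_apply]

theorem dirDeriv_linearForm (o u a : Fin (m + 1) → K) :
    dirDeriv o u (linearForm a) = a ⬝ᵥ u := by
  classical
  simp only [dirDeriv_apply, linearForm, map_sum, dotProduct]
  refine Finset.sum_congr rfl fun i _ => ?_
  rw [Finset.sum_eq_single i]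
  · simp [Derivation.leibniz, mul_comm]
  · intro j _ hj
    simp [Derivation.leibniz, pderiv_X_of_ne hj.symm]
  · simp

theorem dirDeriv_pow (o u : Fin (m + 1) → K) (f : MvPolynomial (Fin (m + 1)) K) (n : ℕ) :
    dirDeriv o u (f ^ n) = n * eval o f ^ (n - 1) * dirDeriv o u f := by
  induction n with
  | zero => simpa using dirDeriv_C o u 1
  | succ n ih =>
    rw [pow_succ, dirDeriv_mul, ih]
    rcases n with _ | n
    · simp
    · simp [pow_succ]; ring

/-- Every linear functional on `K^(m+1)` is the dot product with a vector. -/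
theorem Module.Dual.exists_eq_dotProduct (f : Module.Dual K (Fin (m + 1) → K)) :
    ∃ a : Fin (m + 1) → K, ∀ v, f v = a ⬝ᵥ v := by
  classical
  refine ⟨fun i => f (Pi.single i 1), fun v => ?_⟩
  rw [LinearMap.pi_apply_eq_sum_univ f v]
  simp only [dotProduct, smul_eq_mul]
  refine Finset.sum_congr rfl fun i _ => ?_
  rw [mul_comm]
  congr 2
  ext j
  simp [Pi.single_apply, eq_comm]

/-- Supplies the linear forms dual to an independent frame, used throughout as test forms. -/
theorem exists_dotProduct_eq_of_linearIndependent {ι : Type*} {v : ι → Fin (m + 1) → K}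
    (hv : LinearIndependent K v) (γ : ι → K) :
    ∃ a : Fin (m + 1) → K, ∀ i, a ⬝ᵥ v i = γ i := by
  obtain ⟨g, hg⟩ := LinearMap.exists_extend
    ((Finsupp.linearCombination K γ) ∘ₗ hv.repr)
  obtain ⟨a, ha⟩ := Module.Dual.exists_eq_dotProduct g
  refine ⟨a, fun i => ?_⟩
  have h := LinearMap.congr_fun hg ⟨v i, Submodule.subset_span ⟨i, rfl⟩⟩
  rw [LinearMap.comp_apply, LinearMap.comp_apply] at h
  rw [← ha]
  refine h.trans ?_
  rw [hv.repr_eq_single i _ rfl]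
  simp

/-- Over an infinite field there is a hyperplane containing a given subspace and avoiding
finitely many given vectors outside of it. -/
theorem exists_dotProduct_ne_zero [Infinite K] {ι : Type*} [Finite ι]
    (W : Submodule K (Fin (m + 1) → K)) (v : ι → Fin (m + 1) → K) (hv : ∀ i, v i ∉ W) :
    ∃ a : Fin (m + 1) → K, (∀ w ∈ W, a ⬝ᵥ w = 0) ∧ ∀ i, a ⬝ᵥ v i ≠ 0 := by
  obtain ⟨f, hf⟩ := Module.exists_dual_forall_apply_ne_zero (K := K) (fun i => W.mkQ (v i))
    (fun i => by simpa using hv i)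
  obtain ⟨a, ha⟩ := Module.Dual.exists_eq_dotProduct (f ∘ₗ W.mkQ)
  refine ⟨a, fun w hw => ?_, fun i => ?_⟩
  · rw [← ha, LinearMap.comp_apply, W.mkQ_apply, (Submodule.Quotient.mk_eq_zero W).mpr hw, map_zero]
  · rw [← ha]; exact hf i

theorem Projectivization.rep_notMem_span_singleton {V : Type*} [AddCommGroup V] [Module K V]
    {p q : ℙ K V} (h : p ≠ q) : p.rep ∉ Submodule.span K {q.rep} := by
  rw [Submodule.mem_span_singleton]
  rintro ⟨c, hc⟩
  apply h
  rw [← p.mk_rep, ← q.mk_rep, Projectivization.mk_eq_mk_iff']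
  exact ⟨c, hc⟩

end Forms

/-! ### Relations between a tangent vector and points: lower bounds on the number of points. -/

section TangentRelation

variable {K : Type*} [Field K] {m : ℕ}

/-- The vectors `O.rep`, `u` and `p.rep` for `p ∈ S`. -/
def tangentFrame (O : ℙ K (Fin (m + 1) → K)) (u : Fin (m + 1) → K)
    (S : Finset (ℙ K (Fin (m + 1) → K))) : Fin 2 ⊕ S → Fin (m + 1) → K :=
  Sum.elim ![O.rep, u] fun p => p.1.rep

/-- On forms of degree `d`, the combination of the derivative at `O` in the direction `u`, the
evaluation at `O` and the evaluations at `S` with coefficients `b`, `a` and `c` agrees with the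
combination of the evaluations at `T` with coefficients `l`. -/
def TangentRelation (d : ℕ) (O : ℙ K (Fin (m + 1) → K)) (u : Fin (m + 1) → K)
    (S T : Finset (ℙ K (Fin (m + 1) → K))) (b a : K) (c l : ℙ K (Fin (m + 1) → K) → K) : Prop :=
  ∀ f : MvPolynomial (Fin (m + 1)) K, f.IsHomogeneous d →
    b * dirDeriv O.rep u f + a * eval O.rep f + ∑ p ∈ S, c p * eval p.rep f =
      ∑ q ∈ T, l q * eval q.rep f

variable {d : ℕ} {O : ℙ K (Fin (m + 1) → K)} {u : Fin (m + 1) → K}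
  {S T : Finset (ℙ K (Fin (m + 1) → K))} {b a : K} {c l : ℙ K (Fin (m + 1) → K) → K}

theorem exists_dotProduct_eq_of_tangentFrame (hind : LinearIndependent K (tangentFrame O u S))
    (α β : K) (γ : ℙ K (Fin (m + 1) → K) → K) :
    ∃ x : Fin (m + 1) → K, x ⬝ᵥ O.rep = α ∧ x ⬝ᵥ u = β ∧ ∀ p ∈ S, x ⬝ᵥ p.rep = γ p := by
  obtain ⟨x, hx⟩ := exists_dotProduct_eq_of_linearIndependent hind
    (Sum.elim ![α, β] fun p => γ p.1)
  exact ⟨x, hx (Sum.inl 0), hx (Sum.inl 1), fun p hp => hx (Sum.inr ⟨p, hp⟩)⟩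

/-- Multiplying a relation by a linear form. -/
theorem TangentRelation.mul_linearForm [DecidableEq K] (h : TangentRelation (d + 1) O u S T b a c l)
    (x : Fin (m + 1) → K) :
    TangentRelation d O u S (T.filter fun q => x ⬝ᵥ q.rep ≠ 0) (b * (x ⬝ᵥ O.rep))
      (a * (x ⬝ᵥ O.rep) + b * (x ⬝ᵥ u)) (fun p => c p * (x ⬝ᵥ p.rep))
      (fun q => l q * (x ⬝ᵥ q.rep)) := by
  intro f hf
  have h1 := h (f * linearForm x) (hf.mul (isHomogeneous_linearForm x))
  simp only [dirDeriv_mul, dirDeriv_linearForm, map_mul, eval_linearForm] at h1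
  rw [Finset.sum_filter_of_ne fun q _ hq => by
    intro h0; apply hq; simp only [h0, mul_zero, zero_mul]]
  have h2 : ∀ R : Finset (ℙ K (Fin (m + 1) → K)), ∀ k : ℙ K (Fin (m + 1) → K) → K,
      ∑ p ∈ R, k p * (x ⬝ᵥ p.rep) * eval p.rep f
        = ∑ p ∈ R, k p * (eval p.rep f * (x ⬝ᵥ p.rep)) :=
    fun R k => Finset.sum_congr rfl fun _ _ => by ring
  rw [h2, h2, ← h1]
  ring

/-- A linear form vanishing on the right-hand side of a relation vanishes on the left-hand side. -/
theorem TangentRelation.dotProduct_eq_zero (hind : LinearIndependent K (tangentFrame O u S))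
    (h : TangentRelation (d + 2) O u S T b a c l) (hb : b ≠ 0) (hc : ∀ p ∈ S, c p ≠ 0)
    {x : Fin (m + 1) → K} (hx : ∀ q ∈ T, x ⬝ᵥ q.rep = 0) :
    x ⬝ᵥ O.rep = 0 ∧ x ⬝ᵥ u = 0 ∧ ∀ p ∈ S, x ⬝ᵥ p.rep = 0 := by
  classical
  have key : ∀ f : MvPolynomial (Fin (m + 1)) K, f.IsHomogeneous (d + 1) →
      b * (x ⬝ᵥ O.rep) * dirDeriv O.rep u f +
        (a * (x ⬝ᵥ O.rep) + b * (x ⬝ᵥ u)) * eval O.rep f +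
        ∑ p ∈ S, c p * (x ⬝ᵥ p.rep) * eval p.rep f = 0 := by
    intro f hf
    rw [h.mul_linearForm x f hf, Finset.filter_eq_empty_iff.mpr fun q hq => not_not.mpr (hx q hq)]
    simp
  -- Forms dual to the frame isolate the coefficients one by one: `y^d z` has value 0 and derivative
  -- 1 at `O` and vanishes on `S`, and once `x` vanishes at `O`, the powers of `y` and `w` isolate
  -- `O` and `p`.
  obtain ⟨y, hyO, hyu, hyS⟩ := exists_dotProduct_eq_of_tangentFrame hind 1 0 fun _ => 0
  obtain ⟨z, hzO, hzu, hzS⟩ := exists_dotProduct_eq_of_tangentFrame hind 0 1 fun _ => 0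
  have hO : x ⬝ᵥ O.rep = 0 := by
    have h1 := key (linearForm y ^ d * linearForm z)
      (by simpa using ((isHomogeneous_linearForm y).pow d).mul (isHomogeneous_linearForm z))
    rw [Finset.sum_eq_zero fun p hp => by simp [eval_linearForm, hzS p hp]] at h1
    simpa [dirDeriv_mul, dirDeriv_pow, dirDeriv_linearForm, eval_linearForm, hyO, hyu, hzO, hzu,
      hb] using h1
  refine ⟨hO, ?_, fun p hp => ?_⟩
  · have h1 := key (linearForm y ^ (d + 1)) (by simpa using (isHomogeneous_linearForm y).pow (d + 1))
    rw [Finset.sum_eq_zero fun p hp => by simp [eval_linearForm, hyS p hp]] at h1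
    simpa [eval_linearForm, hO, hyO, hb] using h1
  · obtain ⟨w, hwO, hwu, hwS⟩ := exists_dotProduct_eq_of_tangentFrame hind 0 0
      fun q => if q = p then 1 else 0
    have h1 := key (linearForm w ^ (d + 1)) (by simpa using (isHomogeneous_linearForm w).pow (d + 1))
    rw [Finset.sum_eq_single_of_mem p hp fun q hq hqp => by
      simp [eval_linearForm, hwS q hq, hqp]] at h1
    simpa [eval_linearForm, hO, hwO, hwS p hp, hc p hp] using h1

/-- Dual form of `dotProduct_eq_zero`: every hyperplane through `T` contains the frame. -/
theorem TangentRelation.tangentFrame_mem_span [Infinite K]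
    (hind : LinearIndependent K (tangentFrame O u S))
    (h : TangentRelation (d + 2) O u S T b a c l) (hb : b ≠ 0) (hc : ∀ p ∈ S, c p ≠ 0)
    (i : Fin 2 ⊕ S) :
    tangentFrame O u S i ∈ Submodule.span K (Set.range fun q : T => q.1.rep) := by
  by_contra hi
  obtain ⟨x, hx, hxi⟩ := exists_dotProduct_ne_zero _ (fun _ : Unit => tangentFrame O u S i)
    fun _ => hi
  obtain ⟨hO, hu, hS⟩ := h.dotProduct_eq_zero hind hb hc
    (x := x) fun q hq => hx _ (Submodule.subset_span ⟨⟨q, hq⟩, rfl⟩)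
  refine hxi () ?_
  rcases i with i | p
  · fin_cases i
    · exact hO
    · exact hu
  · exact hS p.1 p.2

theorem TangentRelation.card_add_two_le_finrank [Infinite K]
    (hind : LinearIndependent K (tangentFrame O u S))
    (h : TangentRelation (d + 2) O u S T b a c l) (hb : b ≠ 0) (hc : ∀ p ∈ S, c p ≠ 0) :
    S.card + 2 ≤ Module.finrank K (Submodule.span K (Set.range fun q : T => q.1.rep)) := by
  have h1 := finrank_span_eq_card hind
  rw [Fintype.card_sum, Fintype.card_fin, Fintype.card_coe] at h1
  rw [add_comm S.card 2, ← h1]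
  refine Submodule.finrank_mono (Submodule.span_le.mpr ?_)
  rintro _ ⟨i, rfl⟩
  exact h.tangentFrame_mem_span hind hb hc i

/-- A linear form vanishing on a subspace `W` and at none of the points `O` and `S`, provided
that these do not lie on `W`. -/
theorem exists_dotProduct_ne_zero_of_notMem [Infinite K] (W : Submodule K (Fin (m + 1) → K))
    (hO : O.rep ∉ W) (hS : ∀ p ∈ S, p.rep ∉ W) :
    ∃ x : Fin (m + 1) → K, (∀ w ∈ W, x ⬝ᵥ w = 0) ∧ x ⬝ᵥ O.rep ≠ 0 ∧ ∀ p ∈ S, x ⬝ᵥ p.rep ≠ 0 := by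
  obtain ⟨x, hx, hx'⟩ := exists_dotProduct_ne_zero W
    (fun i : Option S => i.elim O.rep fun p => p.1.rep) (by
      rintro (_ | p)
      · exact hO
      · exact hS p.1 p.2)
  exact ⟨x, hx, hx' none, fun p hp => hx' (some ⟨p, hp⟩)⟩

/-- Induction on the degree: a linear form through one point of `T` that avoids `O` and `S` costs
one degree and at least one point, while the left-hand coefficients stay nonzero. Degree two is the
dimension count `card_add_two_le_finrank`. -/
theorem TangentRelation.card_add_le [Infinite K]
    (hind : LinearIndependent K (tangentFrame O u S))
    (h : TangentRelation (d + 2) O u S T b a c l) (hb : b ≠ 0) (hc : ∀ p ∈ S, c p ≠ 0)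
    (hO : O ∉ T) (hST : Disjoint S T) : S.card + (d + 2) ≤ T.card := by
  classical
  induction d generalizing T b a c l with
  | zero =>
    refine (h.card_add_two_le_finrank hind hb hc).trans ?_
    simpa [Set.finrank] using finrank_range_le_card (R := K) fun q : T => q.1.rep
  | succ d ih =>
    obtain ⟨t, ht⟩ : T.Nonempty := by
      rw [Finset.nonempty_iff_ne_empty]
      rintro rfl
      have h1 := h.card_add_two_le_finrank hind hb hc
      have h2 := finrank_range_le_card (R := K)
        fun q : (∅ : Finset (ℙ K (Fin (m + 1) → K))) => q.1.rep
      rw [Set.finrank, Fintype.card_coe, Finset.card_empty] at h2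
      omega
    obtain ⟨x, hxt, hxO, hxS⟩ := exists_dotProduct_ne_zero_of_notMem (O := O) (S := S)
      (Submodule.span K {t.rep})
      (Projectivization.rep_notMem_span_singleton fun e => hO (e ▸ ht))
      (fun p hp => Projectivization.rep_notMem_span_singleton fun e =>
        Finset.disjoint_left.mp hST hp (e ▸ ht))
    have h1 := ih (h.mul_linearForm x) (mul_ne_zero hb hxO)
      (fun p hp => mul_ne_zero (hc p hp) (hxS p hp))
      (fun hO' => hO (Finset.mem_of_mem_filter _ hO'))
      (hST.mono_right (Finset.filter_subset _ _))
    have h2 : (T.filter fun q => x ⬝ᵥ q.rep ≠ 0).card < T.card :=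
      Finset.card_lt_card (Finset.filter_ssubset.mpr
        ⟨t, ht, not_not.mpr (hxt _ (Submodule.mem_span_singleton_self _))⟩)
    omega

/-- If few points appear on the right-hand side, any two of them are collinear with one of the
points on the left-hand side. -/
theorem TangentRelation.exists_mem_span_pair [Infinite K]
    (hind : LinearIndependent K (tangentFrame O u S))
    (h : TangentRelation (d + 3) O u S T b a c l) (hb : b ≠ 0) (hc : ∀ p ∈ S, c p ≠ 0)
    (hO : O ∉ T) (hST : Disjoint S T) (hcard : T.card ≤ S.card + (d + 3))
    {t t' : ℙ K (Fin (m + 1) → K)} (ht : t ∈ T) (ht' : t' ∈ T) (htt' : t ≠ t') :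
    ∃ e : Option S, (e.elim O fun p => p.1).rep ∈ Submodule.span K {t.rep, t'.rep} := by
  classical
  by_contra! hne
  -- A hyperplane through both points that misses `O` and `S` would remove two points of `T` for a
  -- single degree, against `card_add_le`.
  obtain ⟨x, hxt, hxO, hxS⟩ := exists_dotProduct_ne_zero_of_notMem (O := O) (S := S)
      (Submodule.span K {t.rep, t'.rep}) (hne none) (fun p hp => hne (some ⟨p, hp⟩))
  have h1 := (h.mul_linearForm x).card_add_le hind (mul_ne_zero hb hxO)
      (fun p hp => mul_ne_zero (hc p hp) (hxS p hp))
      (fun hO' => hO (Finset.mem_of_mem_filter _ hO'))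
      (hST.mono_right (Finset.filter_subset _ _))
  have h2 : T.filter (fun q => x ⬝ᵥ q.rep ≠ 0) ⊆ (T.erase t).erase t' := by
    intro q hq
    rw [Finset.mem_filter] at hq
    refine Finset.mem_erase.mpr ⟨?_, Finset.mem_erase.mpr ⟨?_, hq.1⟩⟩
    · rintro rfl; exact hq.2 (hxt _ (Submodule.subset_span (by simp)))
    · rintro rfl; exact hq.2 (hxt _ (Submodule.subset_span (by simp)))
  have h3 := Finset.card_le_card h2
  rw [Finset.card_erase_of_mem (Finset.mem_erase.mpr ⟨htt'.symm, ht'⟩),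
    Finset.card_erase_of_mem ht] at h3
  have h4 : 0 < T.card := Finset.card_pos.mpr ⟨t, ht⟩
  omega

/-- A vector lying on two different lines spanned by pairs of members of a linearly independent
family is a multiple of a member of that family. -/
theorem LinearIndependent.exists_mem_span_singleton_of_mem_span_pair {ι V : Type*} [DecidableEq ι]
    [AddCommGroup V] [Module K V] {v : ι → V} (hv : LinearIndependent K v) {s t : Finset ι}
    (hs : s.card = 2) (ht : t.card = 2) (hst : s ≠ t) {x : V}
    (hxs : x ∈ Submodule.span K (v '' s)) (hxt : x ∈ Submodule.span K (v '' t)) :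
    ∃ i, x ∈ Submodule.span K {v i} := by
  rw [Finsupp.mem_span_image_iff_linearCombination] at hxs hxt
  obtain ⟨f, hf, rfl⟩ := hxs
  obtain ⟨g, hg, hfg⟩ := hxt
  -- By independence both expansions of `x` coincide, so their support lies in `s ∩ t`, which has at
  -- most one element.
  obtain rfl : g = f := hv hfg
  have h1 : g.support ⊆ s ∩ t := Finset.subset_inter (by simpa [Finsupp.mem_supported] using hf)
    (by simpa [Finsupp.mem_supported] using hg)
  have h2 : (s ∩ t).card < 2 := by
    rw [← hs]
    refine Finset.card_lt_card (lt_of_le_of_ne Finset.inter_subset_left fun h => hst ?_)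
    exact Finset.eq_of_subset_of_card_le (Finset.inter_eq_left.mp h) (by omega)
  have h3 : g.support.card ≤ 1 := by have := Finset.card_le_card h1; omega
  have : Nonempty ι := by
    obtain ⟨i, _⟩ := Finset.card_pos.mp (by omega : 0 < s.card)
    exact ⟨i⟩
  obtain ⟨i, r, rfl⟩ := Finsupp.card_support_le_one'.mp h3
  refine ⟨i, ?_⟩
  rw [Finsupp.linearCombination_single]
  exact Submodule.smul_mem _ _ (Submodule.mem_span_singleton_self _)

/-- Otherwise each pair from an independent subset of `T` spans a line meeting `S ∪ {O}`. Different
pairs give different points, because a point on two such lines would belong to `T`. As the subset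
has at least `|S| + 2` elements, there are more pairs than the `|S| + 1` available points. -/
theorem TangentRelation.card_add_lt [Infinite K]
    (hind : LinearIndependent K (tangentFrame O u S))
    (h : TangentRelation (d + 3) O u S T b a c l) (hb : b ≠ 0) (hc : ∀ p ∈ S, c p ≠ 0)
    (hO : O ∉ T) (hST : Disjoint S T) (hS : S.Nonempty) : S.card + (d + 3) < T.card := by
  classical
  by_contra! hcard
  have hrank := h.card_add_two_le_finrank hind hb hc
  obtain ⟨κ, w, hw, hspan, hli⟩ := exists_linearIndependent' K fun q : T => q.1.rep
  have : Fintype κ := Fintype.ofInjective w hw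
  rw [← hspan, finrank_span_eq_card hli] at hrank
  have hne : ∀ (e : Option S) (k : κ),
      (e.elim O fun p => p.1).rep ∉ Submodule.span K {((fun q : T => q.1.rep) ∘ w) k} := by
    rintro (_ | p) k
    · exact Projectivization.rep_notMem_span_singleton fun (e : O = (w k).1) =>
        hO (e ▸ (w k).2)
    · exact Projectivization.rep_notMem_span_singleton fun (e : p.1 = (w k).1) =>
        Finset.disjoint_left.mp hST p.2 (e ▸ (w k).2)
  have hpair : ∀ s : Finset κ, s.card = 2 → ∃ e : Option S, (e.elim O fun p => p.1).rep ∈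
      Submodule.span K (((fun q : T => q.1.rep) ∘ w) '' s) := by
    intro s hs
    obtain ⟨k, k', hkk', rfl⟩ := Finset.card_eq_two.mp hs
    obtain ⟨e, he⟩ := h.exists_mem_span_pair hind hb hc hO hST hcard (w k).2 (w k').2
      (fun e => hkk' (hw (Subtype.ext e)))
    exact ⟨e, by simpa [Set.image_pair] using he⟩
  choose! φ hφ using hpair
  have hinj : Set.InjOn φ (Finset.powersetCard 2 (Finset.univ : Finset κ) : Set (Finset κ)) := by
    intro s hs t ht hst
    simp only [Finset.mem_coe, Finset.mem_powersetCard] at hs ht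
    by_contra hne'
    obtain ⟨k, hk⟩ := hli.exists_mem_span_singleton_of_mem_span_pair hs.2 ht.2 hne'
      (hφ s hs.2) (hst ▸ hφ t ht.2)
    exact hne _ _ hk
  have h1 := Finset.card_le_card_of_injOn (t := (Finset.univ : Finset (Option S))) φ
    (fun _ _ => Finset.mem_coe.mpr (Finset.mem_univ _)) hinj
  rw [Finset.card_powersetCard, Finset.card_univ, Finset.card_univ, Fintype.card_option,
    Fintype.card_coe] at h1
  have h2 : 0 < S.card := hS.card_pos
  -- The contradiction is `C(s+2, 2) = C(s+1, 2) + (s+1) > s+1` for `s ≥ 1`.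
  have h3 := Nat.choose_le_choose 2 hrank
  have h4 : (S.card + 2).choose 2 = (S.card + 1).choose 2 + (S.card + 1) := by
    rw [Nat.choose_succ_succ' (S.card + 1) 1, Nat.choose_one_right]; ring
  have h5 : 0 < (S.card + 1).choose 2 := Nat.choose_pos (by omega)
  omega

end TangentRelation

/-! ### Forms separating points and tangent vectors. -/

section Separation

variable {K : Type*} [Field K] {m : ℕ}

theorem exists_dotProduct_rep_eq_zero {p q : ℙ K (Fin (m + 1) → K)} (h : p ≠ q) :
    ∃ x : Fin (m + 1) → K, x ⬝ᵥ q.rep = 0 ∧ x ⬝ᵥ p.rep ≠ 0 := by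
  obtain ⟨f, hf, hf'⟩ := Submodule.exists_le_ker_of_notMem
    (Projectivization.rep_notMem_span_singleton h)
  obtain ⟨x, hx⟩ := Module.Dual.exists_eq_dotProduct f
  refine ⟨x, ?_, by rwa [← hx]⟩
  rw [← hx]
  exact hf' (Submodule.mem_span_singleton_self _)

/-- There is a form of degree `n` that vanishes at `n` given points and not at another one. -/
theorem exists_form_eval_ne_zero (R : Finset (ℙ K (Fin (m + 1) → K)))
    (q : ℙ K (Fin (m + 1) → K)) (hq : q ∉ R) {n : ℕ} (hn : R.card ≤ n) :
    ∃ f : MvPolynomial (Fin (m + 1)) K, f.IsHomogeneous n ∧ eval q.rep f ≠ 0 ∧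
      ∀ p ∈ R, eval p.rep f = 0 := by
  classical
  induction R using Finset.induction_on generalizing n with
  | empty =>
    obtain ⟨i, hi⟩ := Function.ne_iff.mp q.rep_nonzero
    exact ⟨X i ^ n, isHomogeneous_X_pow i n, by simpa using pow_ne_zero n hi, by simp⟩
  | insert p R hp ih =>
    rw [Finset.card_insert_of_notMem hp] at hn
    obtain ⟨n, rfl⟩ : ∃ k, n = k + 1 := ⟨n - 1, by omega⟩
    rw [Finset.mem_insert, not_or] at hq
    obtain ⟨f, hf, hfq, hfR⟩ := ih hq.2 (n := n) (by omega)
    obtain ⟨x, hxp, hxq⟩ := exists_dotProduct_rep_eq_zero hq.1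
    refine ⟨f * linearForm x, hf.mul (isHomogeneous_linearForm x), ?_, ?_⟩
    · rw [map_mul, eval_linearForm]; exact mul_ne_zero hfq hxq
    · intro r hr
      rw [map_mul, eval_linearForm]
      rcases Finset.mem_insert.mp hr with rfl | hr
      · rw [hxp, mul_zero]
      · rw [hfR r hr, zero_mul]

variable {d : ℕ} {O : ℙ K (Fin (m + 1) → K)} {u : Fin (m + 1) → K}
  {S T : Finset (ℙ K (Fin (m + 1) → K))} {b a : K} {c l : ℙ K (Fin (m + 1) → K) → K}

/-- The points of a shortest decomposition of a tangent vector lie on the tangent line. -/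
theorem TangentRelation.mem_span_pair [Infinite K]
    (h : TangentRelation (d + 1) O u ∅ T b a c l) (hl : ∀ q ∈ T, l q ≠ 0) (hT : T.card ≤ d + 1)
    {q : ℙ K (Fin (m + 1) → K)} (hq : q ∈ T) : q.rep ∈ Submodule.span K {O.rep, u} := by
  classical
  by_contra hne
  -- Multiplying by `x` kills the tangent side; `f` then kills every point of `T` except `q`, which
  -- leaves `l q` times nonzero factors equal to zero.
  obtain ⟨x, hx, hxq⟩ := exists_dotProduct_ne_zero _ (fun _ : Unit => q.rep) fun _ => hne
  specialize hxq ()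
  obtain ⟨f, hf, hfq, hfT⟩ := exists_form_eval_ne_zero (T.erase q) q (Finset.notMem_erase q T)
    (n := d) (by rw [Finset.card_erase_of_mem hq]; omega)
  have h1 := h.mul_linearForm x f hf
  rw [hx O.rep (Submodule.subset_span (by simp)), hx u (Submodule.subset_span (by simp)),
    Finset.sum_eq_single_of_mem q (Finset.mem_filter.mpr ⟨hq, hxq⟩) fun r hr hrq => by
      rw [hfT r (Finset.mem_erase.mpr ⟨hrq, Finset.mem_of_mem_filter _ hr⟩), mul_zero]] at h1
  simp [hl q hq, hxq, hfq] at h1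

/-- The derivative at `O` in the direction `u`, the value at `O` and the values at the points
of `S` of a form of degree `n`. -/
def jetEval (n : ℕ) (O : ℙ K (Fin (m + 1) → K)) (u : Fin (m + 1) → K)
    (S : Finset (ℙ K (Fin (m + 1) → K))) :
    homogeneousSubmodule (Fin (m + 1)) K n →ₗ[K] (Fin 2 ⊕ S → K) :=
  LinearMap.pi (Sum.elim
    ![dirDeriv O.rep u ∘ₗ Submodule.subtype _, (aeval O.rep).toLinearMap ∘ₗ Submodule.subtype _]
    fun p => (aeval p.1.rep).toLinearMap ∘ₗ Submodule.subtype _)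

theorem jetEval_inl_zero {n : ℕ} (f : homogeneousSubmodule (Fin (m + 1)) K n) :
    jetEval n O u S f (Sum.inl 0) = dirDeriv O.rep u f := rfl

theorem jetEval_inl_one {n : ℕ} (f : homogeneousSubmodule (Fin (m + 1)) K n) :
    jetEval n O u S f (Sum.inl 1) = eval O.rep (f : MvPolynomial (Fin (m + 1)) K) := by
  simp [jetEval, aeval_eq_eval]

theorem jetEval_inr {n : ℕ} (f : homogeneousSubmodule (Fin (m + 1)) K n) (p : S) :
    jetEval n O u S f (Sum.inr p) = eval p.1.rep (f : MvPolynomial (Fin (m + 1)) K) := by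
  simp [jetEval, aeval_eq_eval]

/-- Shows that the tangent vector together with `S` imposes `|S| + 2` independent conditions, hence
has degree `|S| + 2`. -/
theorem jetEval_surjective (hu : LinearIndependent K ![O.rep, u]) (hO : O ∉ S) {n : ℕ}
    (hn : S.card + 1 ≤ n) : Function.Surjective (jetEval n O u S) := by
  classical
  rw [← LinearMap.range_eq_top, eq_top_iff]
  rintro y -
  obtain ⟨n, rfl⟩ : ∃ k, n = k + 1 := ⟨n - 1, by omega⟩
  have hS : ∀ p : S, Pi.single (Sum.inr p) 1 ∈ LinearMap.range (jetEval (n + 1) O u S) := by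
    intro p
    have hpO : p.1 ≠ O := fun e => hO (e ▸ p.2)
    obtain ⟨x, hxO, hxp⟩ := exists_dotProduct_rep_eq_zero hpO
    -- Both `f` and `x` vanish at `O`, so their product has zero value and zero derivative there.
    obtain ⟨f, hf, hfp, hfS⟩ := exists_form_eval_ne_zero (insert O (S.erase p)) p
      (by simp [hpO]) (n := n) (by
        refine (Finset.card_insert_le _ _).trans ?_
        rw [Finset.card_erase_add_one p.2]; omega)
    have hf0 := hfS O (Finset.mem_insert_self _ _)
    refine ⟨(eval p.1.rep f * x ⬝ᵥ p.1.rep)⁻¹ • ⟨f * linearForm x,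
      hf.mul (isHomogeneous_linearForm x)⟩, ?_⟩
    rw [map_smul]
    ext i
    rw [Pi.smul_apply]
    rcases i with i | q
    · fin_cases i
      · simp [jetEval_inl_zero, dirDeriv_mul, hf0, hxO, eval_linearForm]
      · simp [jetEval_inl_one, hf0]
    · rw [jetEval_inr]
      by_cases hqp : q = p
      · subst hqp
        simp only [map_mul, eval_linearForm, Pi.single_eq_same, smul_eq_mul]
        exact inv_mul_cancel₀ (mul_ne_zero hfp hxp)
      · rw [Pi.single_eq_of_ne (by simpa using hqp)]
        simp [hfS q (Finset.mem_insert_of_mem (Finset.mem_erase.mpr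
          ⟨fun e => hqp (Subtype.ext e), q.2⟩))]
  obtain ⟨g, hg, hgO, hgS⟩ := exists_form_eval_ne_zero S O hO (n := n) (by omega)
  -- These values of `x` at `O` and `u` solve the Leibniz equations that give `g · x` the prescribed
  -- value and derivative at `O`.
  obtain ⟨x, hx⟩ := exists_dotProduct_eq_of_linearIndependent hu
    ![y (Sum.inl 1) / eval O.rep g,
      (y (Sum.inl 0) - y (Sum.inl 1) / eval O.rep g * dirDeriv O.rep u g) / eval O.rep g]
  have hx0 : x ⬝ᵥ O.rep = _ := hx 0
  have hx1 : x ⬝ᵥ u = _ := hx 1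
  have hy : y = jetEval (n + 1) O u S ⟨g * linearForm x, hg.mul (isHomogeneous_linearForm x)⟩ +
      ∑ p : S, y (Sum.inr p) • Pi.single (Sum.inr p) 1 := by
    ext i
    rcases i with i | q
    · rw [Pi.add_apply, Finset.sum_apply, Finset.sum_eq_zero (by
        intro p _; rw [Pi.smul_apply, Pi.single_eq_of_ne (by simp), smul_zero]), add_zero]
      fin_cases i
      · simp only [Fin.zero_eta, jetEval_inl_zero, dirDeriv_mul, dirDeriv_linearForm,
          eval_linearForm, hx0, hx1]
        simp only [Matrix.cons_val_zero, Matrix.cons_val_one]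
        field_simp
        ring
      · simp only [Fin.mk_one, jetEval_inl_one, map_mul, eval_linearForm, hx0]
        simp only [Matrix.cons_val_zero]
        field_simp
    · rw [Pi.add_apply, jetEval_inr, Finset.sum_apply, Finset.sum_eq_single q]
      · simp [hgS q q.2]
      · intro p _ hp
        rw [Pi.smul_apply, Pi.single_eq_of_ne (by simpa using hp.symm), smul_zero]
      · simp
  rw [hy]
  exact Submodule.add_mem _ ⟨_, rfl⟩ (Submodule.sum_mem _ fun p _ => Submodule.smul_mem _ _ (hS p))

/-- An induction principle for homogeneous polynomials. -/
theorem MvPolynomial.IsHomogeneous.induction_on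
    {P : ℕ → MvPolynomial (Fin (m + 1)) K → Prop} (hC : ∀ r, P 0 (C r))
    (hadd : ∀ n f g, P n f → P n g → P n (f + g))
    (hmul : ∀ n x f, P n f → P (n + 1) (linearForm x * f))
    {n : ℕ} {f : MvPolynomial (Fin (m + 1)) K} (hf : f.IsHomogeneous n) : P n f := by
  rw [← mem_homogeneousSubmodule, ← homogeneousSubmodule_one_pow] at hf
  induction hf using Submodule.pow_induction_on_left' with
  | algebraMap r => exact hC r
  | add x y i hx hy ihx ihy => exact hadd _ _ _ ihx ihy
  | mem_mul x hx i y hy ih =>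
    obtain ⟨z, rfl⟩ := MvPolynomial.IsHomogeneous.exists_eq_linearForm hx
    exact hmul _ _ _ ih

/-! ### Restriction to the tangent line and the upper bound. -/

/-- The two leading coefficients of the restriction of a form to the line `t ↦ t o + u`. -/
theorem aeval_line_of_isHomogeneous (o u : Fin (m + 1) → K) {n : ℕ}
    {f : MvPolynomial (Fin (m + 1)) K} (hf : f.IsHomogeneous n) :
    (aeval (fun i => Polynomial.C (o i) * Polynomial.X + Polynomial.C (u i)) f).natDegree ≤ n ∧
    (aeval (fun i => Polynomial.C (o i) * Polynomial.X + Polynomial.C (u i)) f).coeff n =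
      eval o f ∧
    (Polynomial.X * aeval (fun i => Polynomial.C (o i) * Polynomial.X + Polynomial.C (u i))
      f).coeff n = dirDeriv o u f := by
  -- The factor `X` turns the coefficient of index `n - 1` into one of index `n`, which is correctly
  -- zero when `n = 0`.
  refine hf.induction_on (P := fun n f =>
    (aeval (fun i => Polynomial.C (o i) * Polynomial.X + Polynomial.C (u i)) f).natDegree ≤ n ∧
    (aeval (fun i => Polynomial.C (o i) * Polynomial.X + Polynomial.C (u i)) f).coeff n =
      eval o f ∧
    (Polynomial.X * aeval (fun i => Polynomial.C (o i) * Polynomial.X + Polynomial.C (u i))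
      f).coeff n = dirDeriv o u f) ?_ ?_ ?_
  · intro r
    simp [dirDeriv_C, Polynomial.algebraMap_eq]
  · intro n f g hf hg
    simp only [map_add, mul_add, Polynomial.coeff_add, hf.2.1, hg.2.1, hf.2.2, hg.2.2]
    exact ⟨(Polynomial.natDegree_add_le _ _).trans (max_le hf.1 hg.1), trivial, trivial⟩
  · intro n x f hf
    have hx : aeval (fun i => Polynomial.C (o i) * Polynomial.X + Polynomial.C (u i))
        (linearForm x) = Polynomial.C (x ⬝ᵥ o) * Polynomial.X + Polynomial.C (x ⬝ᵥ u) := by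
      simp only [linearForm, dotProduct, map_sum, map_mul, aeval_X, Finset.sum_mul,
        ← Finset.sum_add_distrib, MvPolynomial.algHom_C, Polynomial.algebraMap_eq]
      exact Finset.sum_congr rfl fun i _ => by ring
    rw [map_mul, hx, map_mul, eval_linearForm, dirDeriv_mul, dirDeriv_linearForm, eval_linearForm]
    obtain ⟨h1, h2, h3⟩ := hf
    refine ⟨?_, ?_, ?_⟩
    · refine Polynomial.natDegree_mul_le.trans ?_
      have := Polynomial.natDegree_linear_le (a := x ⬝ᵥ o) (b := x ⬝ᵥ u)
      omega
    · rw [add_mul, Polynomial.coeff_add, mul_assoc, Polynomial.coeff_C_mul, Polynomial.coeff_C_mul,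
        Polynomial.coeff_X_mul, h2, Polynomial.coeff_eq_zero_of_natDegree_lt (by omega), mul_zero,
        add_zero]
    · rw [Polynomial.coeff_X_mul, add_mul, Polynomial.coeff_add, mul_assoc, Polynomial.coeff_C_mul,
        Polynomial.coeff_C_mul, h3, h2]
      ring

theorem Projectivization.mk_smul_add_injective {o u : Fin (m + 1) → K}
    (hu : LinearIndependent K ![o, u]) {s t : K} (hs : s • o + u ≠ 0) (ht : t • o + u ≠ 0)
    (h : Projectivization.mk K _ hs = Projectivization.mk K _ ht) : s = t := by
  obtain ⟨x, hx⟩ := exists_dotProduct_eq_of_linearIndependent hu ![1, 0]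
  obtain ⟨y, hy⟩ := exists_dotProduct_eq_of_linearIndependent hu ![0, 1]
  have hx0 : x ⬝ᵥ o = 1 := hx 0
  have hx1 : x ⬝ᵥ u = 0 := hx 1
  have hy0 : y ⬝ᵥ o = 0 := hy 0
  have hy1 : y ⬝ᵥ u = 1 := hy 1
  obtain ⟨r, hr⟩ := (Projectivization.mk_eq_mk_iff' K _ _ hs ht).mp h
  have h1 := congrArg (y ⬝ᵥ ·) hr
  have h2 := congrArg (x ⬝ᵥ ·) hr
  simp only [dotProduct_smul, dotProduct_add, hx0, hx1, hy0, hy1, smul_eq_mul] at h1 h2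
  have h3 : r = 1 := by simpa using h1
  simpa [h3] using h2.symm

/-- A tangent vector to the Veronese variety is a combination of `d` points. -/
theorem exists_finset_tangent_eq_zero [CharZero K] (hu : LinearIndependent K ![O.rep, u])
    (hb : b ≠ 0) (hd : 0 < d) :
    ∃ E : Finset (ℙ K (Fin (m + 1) → K)), E.card = d ∧
      ∀ f : MvPolynomial (Fin (m + 1)) K, f.IsHomogeneous d → (∀ p ∈ E, VanishesAt f p) →
        b * dirDeriv O.rep u f + a * eval O.rep f = 0 := by
  classical
  have hd' : (d : K) ≠ 0 := Nat.cast_ne_zero.mpr hd.ne'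
  -- A common shift of `0, …, d - 1` making the `d` parameters sum to `a / b`; characteristic zero
  -- allows the division and keeps them distinct.
  let e : K := (a / b - ∑ k ∈ Finset.range d, (k : K)) / d
  let x : ℕ → K := fun k => k + e
  have hx : Function.Injective x := fun i j h => by simpa [x] using h
  have hsum : ∑ k ∈ Finset.range d, x k = a / b := by
    simp only [x, Finset.sum_add_distrib, Finset.sum_const, Finset.card_range, nsmul_eq_mul, e]
    field_simp
    ring
  have hne : ∀ t : K, t • O.rep + u ≠ 0 := by
    intro t h
    have := LinearIndependent.pair_iff.mp hu t 1 (by simpa using h)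
    exact one_ne_zero this.2
  let g : ℕ → ℙ K (Fin (m + 1) → K) := fun k => Projectivization.mk K _ (hne (x k))
  have hg : Function.Injective g := fun i j h =>
    hx (Projectivization.mk_smul_add_injective hu _ _ h)
  refine ⟨(Finset.range d).image g, by rw [Finset.card_image_of_injective _ hg, Finset.card_range],
    fun f hf hfE => ?_⟩
  obtain ⟨h1, h2, h3⟩ := aeval_line_of_isHomogeneous O.rep u hf
  set F := aeval (fun i => Polynomial.C (O.rep i) * Polynomial.X + Polynomial.C (u i)) f with hF
  have hroot : ∀ k ∈ Finset.range d, F.eval (x k) = 0 := by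
    intro k hk
    have h4 := hfE (g k) (Finset.mem_image_of_mem g hk) _ (hne (x k)) rfl
    rw [← h4, hF, ← Polynomial.coe_aeval_eq_eval, ← AlgHom.coe_toRingHom]
    change (Polynomial.aeval (x k)) ((aeval _) f) = _
    rw [← AlgHom.comp_apply, comp_aeval, aeval_eq_eval]
    congr 2
    ext i
    simp only [Polynomial.coe_aeval_eq_eval, Polynomial.eval_add, Polynomial.eval_mul,
      Polynomial.eval_C, Polynomial.eval_X, Pi.add_apply, Pi.smul_apply, smul_eq_mul, mul_comm]
  -- The difference has `d` distinct roots, and its coefficient of degree `d` cancels.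
  have hprod : F = Polynomial.C (eval O.rep f) *
      ∏ k ∈ Finset.range d, (Polynomial.X - Polynomial.C (x k)) := by
    have hmonic := Polynomial.monic_prod_X_sub_C x (Finset.range d)
    have hdeg : (∏ k ∈ Finset.range d, (Polynomial.X - Polynomial.C (x k))).natDegree = d := by
      rw [Polynomial.natDegree_finsetProd_X_sub_C_eq_card, Finset.card_range]
    rw [← sub_eq_zero]
    refine Polynomial.eq_zero_of_natDegree_lt_card_of_eval_eq_zero' _
      ((Finset.range d).image x) ?_ ?_
    · intro t ht
      obtain ⟨k, hk, rfl⟩ := Finset.mem_image.mp ht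
      rw [Polynomial.eval_sub, hroot k hk, Polynomial.eval_mul, Polynomial.eval_prod,
        Finset.prod_eq_zero hk (by simp)]
      simp
    · rw [Finset.card_image_of_injective _ hx, Finset.card_range]
      have hcoeff : (F - Polynomial.C (eval O.rep f) *
          ∏ k ∈ Finset.range d, (Polynomial.X - Polynomial.C (x k))).coeff d = 0 := by
        have h4 := hmonic.coeff_natDegree
        rw [hdeg] at h4
        rw [Polynomial.coeff_sub, Polynomial.coeff_C_mul, h4, h2, mul_one, sub_self]
      have hle : (F - Polynomial.C (eval O.rep f) *
          ∏ k ∈ Finset.range d, (Polynomial.X - Polynomial.C (x k))).natDegree ≤ d :=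
        (Polynomial.natDegree_sub_le _ _).trans
          (max_le h1 ((Polynomial.natDegree_C_mul_le _ _).trans hdeg.le))
      generalize F - Polynomial.C (eval O.rep f) *
          ∏ k ∈ Finset.range d, (Polynomial.X - Polynomial.C (x k)) = G at hcoeff hle ⊢
      refine lt_of_le_of_ne hle fun heq => hd.ne ?_
      rw [← heq, Polynomial.coeff_natDegree, Polynomial.leadingCoeff_eq_zero] at hcoeff
      rw [← heq, hcoeff, Polynomial.natDegree_zero]
  obtain ⟨n, rfl⟩ : ∃ n, d = n + 1 := ⟨d - 1, by omega⟩
  have hD : dirDeriv O.rep u f = eval O.rep f * -(a / b) := by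
    have h4 := Polynomial.prod_X_sub_C_coeff_card_pred (Finset.range (n + 1)) x (by simp)
    rw [Finset.card_range, Nat.add_sub_cancel, hsum] at h4
    rw [← h3, Polynomial.coeff_X_mul, hprod, Polynomial.coeff_C_mul, h4]
  rw [hD]
  field_simp
  ring

end Separation

/-! ### Connected schemes of degree two are tangent vectors. -/

section DoublePoint

variable {K : Type*} [Field K] {m : ℕ}

instance finite_homogeneousSubmodule (n : ℕ) :
    Module.Finite K (homogeneousSubmodule (Fin (m + 1)) K n) :=
  Module.Finite.iff_fg.mpr (homogeneousSubmodule_fg _ _ n)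

theorem VanishesAt.of_rep {f : MvPolynomial (Fin (m + 1)) K} {n : ℕ} (hf : f.IsHomogeneous n)
    {p : ℙ K (Fin (m + 1) → K)} (h : eval p.rep f = 0) : VanishesAt f p := by
  intro v hv hp
  rw [← p.mk_rep, Projectivization.mk_eq_mk_iff'] at hp
  obtain ⟨c, rfl⟩ := hp
  rw [hf.eval_smul_vec, h, mul_zero]

theorem VanishesAt.eval_rep {f : MvPolynomial (Fin (m + 1)) K} {p : ℙ K (Fin (m + 1) → K)}
    (h : VanishesAt f p) : eval p.rep f = 0 :=
  h p.rep p.rep_nonzero p.mk_rep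

namespace ProjSubscheme

theorem mem_support_of_eval_eq_zero (A : ProjSubscheme K m) (p : ℙ K (Fin (m + 1) → K))
    (h : ∀ f ∈ A.ideal, eval p.rep f = 0) : p ∈ A.support := by
  intro f hf v hv hp
  rw [← sum_homogeneousComponent f, map_sum]
  exact Finset.sum_eq_zero fun n _ =>
    VanishesAt.of_rep (homogeneousComponent_isHomogeneous n f)
      (h _ (A.homogeneous f hf n)) v hv hp

theorem mem_ideal_of_pow_le (A : ProjSubscheme K m) (f : MvPolynomial (Fin (m + 1)) K) (k : ℕ)
    (h : ∀ g ∈ Ideal.span (Set.range (X : Fin (m + 1) → MvPolynomial (Fin (m + 1)) K)) ^ k,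
      g * f ∈ A.ideal) : f ∈ A.ideal := by
  induction k with
  | zero => simpa using h 1 (by simp)
  | succ k ih =>
    refine ih fun g hg => A.saturated _ fun i => ?_
    rw [← mul_assoc]
    refine h _ ?_
    rw [pow_succ']
    exact Ideal.mul_mem_mul (Ideal.subset_span ⟨i, rfl⟩) hg

variable {A : ProjSubscheme K m} {O : ℙ K (Fin (m + 1) → K)}

/-- A linear form not vanishing at the only point of a scheme is a nonzerodivisor on it. -/
theorem mem_ideal_of_linearForm_mul_mem [IsAlgClosed K] (hO : A.support = {O})
    {x : Fin (m + 1) → K} (hx : x ⬝ᵥ O.rep ≠ 0) {f : MvPolynomial (Fin (m + 1)) K}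
    (hf : linearForm x * f ∈ A.ideal) : f ∈ A.ideal := by
  -- The colon ideal `(I : f)`. It contains `I`, so its zeros lie on the line `O`, and it contains
  -- `x`, which leaves only the origin. By the Nullstellensatz it contains a power of the irrelevant
  -- ideal, and saturation gives `f ∈ I`.
  let J : Ideal (MvPolynomial (Fin (m + 1)) K) :=
    Submodule.comap (LinearMap.toSpanSingleton _ _ f) A.ideal
  have hJ : ∀ g, g ∈ J ↔ g * f ∈ A.ideal := fun g => Iff.rfl
  have hzero : ∀ v ∈ zeroLocus K J, v = 0 := by
    intro v hv
    by_contra hv0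
    have hp : Projectivization.mk K v hv0 ∈ A.support := by
      obtain ⟨c, hc⟩ := (Projectivization.mk_eq_mk_iff' K _ _ (Projectivization.rep_nonzero _)
        hv0).mp (Projectivization.mk K v hv0).mk_rep
      refine A.mem_support_of_eval_eq_zero _ fun g hg => ?_
      rw [← sum_homogeneousComponent g, map_sum]
      refine Finset.sum_eq_zero fun n _ => ?_
      have h1 := hv _ ((hJ (homogeneousComponent n g)).mpr
        (A.ideal.mul_mem_right f (A.homogeneous g hg n)))
      rw [aeval_eq_eval] at h1
      rw [← hc, (homogeneousComponent_isHomogeneous n g).eval_smul_vec]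
      exact mul_eq_zero_of_right _ h1
    rw [hO, Set.mem_singleton_iff] at hp
    obtain ⟨c, hc⟩ := (Projectivization.mk_eq_mk_iff' K _ _ O.rep_nonzero hv0).mp
      (O.mk_rep.trans hp.symm)
    have h1 := hv _ ((hJ _).mpr hf)
    rw [aeval_eq_eval, eval_linearForm] at h1
    rw [← hc, dotProduct_smul, h1, smul_zero] at hx
    exact hx rfl
  have hle : Ideal.span (Set.range (X : Fin (m + 1) → MvPolynomial (Fin (m + 1)) K)) ≤
      J.radical := by
    rw [Ideal.span_le]
    rintro _ ⟨i, rfl⟩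
    rw [← vanishingIdeal_zeroLocus_eq_radical (K := K)]
    intro v hv
    simp [hzero v hv]
  obtain ⟨k, hk⟩ := Ideal.exists_pow_le_of_le_radical_of_fg hle
    (Submodule.fg_span (Set.finite_range _))
  exact A.mem_ideal_of_pow_le f k fun g hg => hk hg

theorem mem_ideal_of_linearForm_pow_mul_mem [IsAlgClosed K] (hO : A.support = {O})
    {x : Fin (m + 1) → K} (hx : x ⬝ᵥ O.rep ≠ 0) {f : MvPolynomial (Fin (m + 1)) K} (k : ℕ)
    (hf : linearForm x ^ k * f ∈ A.ideal) : f ∈ A.ideal := by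
  induction k with
  | zero => simpa using hf
  | succ k ih =>
    refine ih (mem_ideal_of_linearForm_mul_mem hO hx ?_)
    rwa [← mul_assoc, ← pow_succ']

theorem mem_formsThrough {n : ℕ} (f : homogeneousSubmodule (Fin (m + 1)) K n) :
    f ∈ A.formsThrough n ↔ (f : MvPolynomial (Fin (m + 1)) K) ∈ A.ideal := Iff.rfl

/-- Three forms of the same degree are dependent modulo the ideal of a scheme of degree two. -/
theorem HasDegree.exists_relation [IsAlgClosed K] (hA : A.HasDegree 2) (hO : A.support = {O})
    {n : ℕ} (f : Fin 3 → MvPolynomial (Fin (m + 1)) K) (hf : ∀ i, (f i).IsHomogeneous n) :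
    ∃ c : Fin 3 → K, c ≠ 0 ∧ ∑ i, C (c i) * f i ∈ A.ideal := by
  obtain ⟨N, hN⟩ := Filter.eventually_atTop.mp hA
  obtain ⟨x, -, hx⟩ := exists_dotProduct_ne_zero (⊥ : Submodule K (Fin (m + 1) → K))
    (fun _ : Unit => O.rep) fun _ => by simpa using O.rep_nonzero
  specialize hx ()
  -- Only large degrees are known to have a two-dimensional quotient; the power of the
  -- nonzerodivisor `x` moves the forms there and is cancelled afterwards.
  have hg : ∀ i, (linearForm x ^ N * f i).IsHomogeneous (N + n) := fun i => by
    simpa using ((isHomogeneous_linearForm x).pow N).mul (hf i)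
  have hdep : ¬ LinearIndependent K fun i =>
      (A.formsThrough (N + n)).mkQ ⟨linearForm x ^ N * f i, hg i⟩ := by
    intro h
    have h1 := h.fintype_card_le_finrank
    rw [hN (N + n) (by omega), Fintype.card_fin] at h1
    omega
  rw [Fintype.not_linearIndependent_iff] at hdep
  obtain ⟨c, hc, i, hi⟩ := hdep
  refine ⟨c, fun h => hi (congrFun h i), mem_ideal_of_linearForm_pow_mul_mem hO hx N ?_⟩
  simp_rw [← map_smul, ← map_sum] at hc
  rw [Submodule.mkQ_apply, Submodule.Quotient.mk_eq_zero, mem_formsThrough] at hc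
  convert hc using 1
  simp only [AddSubmonoidClass.coe_finsetSum, Submodule.coe_smul, Finset.mul_sum, smul_eq_C_mul]
  exact Finset.sum_congr rfl fun i _ => by ring

/-- If the ideal contained all linear forms through `O`, every form of degree `n` would be congruent
to a multiple of `x^n`, and the degree would be at most one. -/
theorem HasDegree.exists_linearForm_notMem [Infinite K] (hA : A.HasDegree 2) :
    ∃ x : Fin (m + 1) → K, x ⬝ᵥ O.rep = 0 ∧ linearForm x ∉ A.ideal := by
  by_contra! hcon
  obtain ⟨N, hN⟩ := hA.exists
  obtain ⟨x, -, hx⟩ := exists_dotProduct_ne_zero (⊥ : Submodule K (Fin (m + 1) → K))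
    (fun _ : Unit => O.rep) fun _ => by simpa using O.rep_nonzero
  specialize hx ()
  have hlin : ∀ z, linearForm z - C (z ⬝ᵥ O.rep / x ⬝ᵥ O.rep) * linearForm x ∈ A.ideal := by
    intro z
    have := hcon (z + (-(z ⬝ᵥ O.rep / x ⬝ᵥ O.rep)) • x) (by
      rw [add_dotProduct, smul_dotProduct, smul_eq_mul]
      field_simp
      ring)
    rw [linearForm_add, linearForm_smul] at this
    simpa [sub_eq_add_neg] using this
  have key : ∀ n (f : MvPolynomial (Fin (m + 1)) K), f.IsHomogeneous n →
      ∃ c : K, f - C c * linearForm x ^ n ∈ A.ideal := by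
    intro n f hf
    refine hf.induction_on (P := fun n f => ∃ c : K, f - C c * linearForm x ^ n ∈ A.ideal)
      (fun r => ⟨r, by simp⟩) ?_ ?_
    · rintro n f g ⟨c, hc⟩ ⟨c', hc'⟩
      refine ⟨c + c', ?_⟩
      convert A.ideal.add_mem hc hc' using 1
      rw [C_add]; ring
    · rintro n z f ⟨c, hc⟩
      refine ⟨z ⬝ᵥ O.rep / x ⬝ᵥ O.rep * c, ?_⟩
      convert A.ideal.add_mem (A.ideal.mul_mem_left (linearForm z) hc)
        (A.ideal.mul_mem_left (C c * linearForm x ^ n) (hlin z)) using 1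
      rw [C_mul]; ring
  have h1 := finrank_le_one (R := K) ((A.formsThrough N).mkQ ⟨linearForm x ^ N, by
    simpa using (isHomogeneous_linearForm x).pow N⟩) (by
      intro w
      obtain ⟨f, rfl⟩ := (A.formsThrough N).mkQ_surjective w
      obtain ⟨c, hc⟩ := key N f f.2
      refine ⟨c, ?_⟩
      rw [← map_smul, ← sub_eq_zero, ← map_sub, Submodule.mkQ_apply,
        Submodule.Quotient.mk_eq_zero, mem_formsThrough, ← neg_mem_iff]
      simpa [smul_eq_C_mul] using hc)
  omega

/-- A connected zero-dimensional scheme of degree two is a tangent vector. -/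
theorem HasDegree.exists_tangent [IsAlgClosed K] (hA : A.HasDegree 2) (hO : A.support = {O}) :
    ∃ u : Fin (m + 1) → K, LinearIndependent K ![O.rep, u] ∧
      ∀ (n : ℕ) (f : MvPolynomial (Fin (m + 1)) K), f.IsHomogeneous n →
        (f ∈ A.ideal ↔ eval O.rep f = 0 ∧ dirDeriv O.rep u f = 0) := by
  have heval : ∀ f ∈ A.ideal, eval O.rep f = 0 := fun f hf =>
    VanishesAt.eval_rep ((hO ▸ Set.mem_singleton O : O ∈ A.support) f hf)
  obtain ⟨z, hzO, hz⟩ := hA.exists_linearForm_notMem (O := O)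
  let I₁ : Submodule K (Fin (m + 1) → K) :=
    { carrier := {a | linearForm a ∈ A.ideal}
      zero_mem' := by simp [linearForm]
      add_mem' := fun {a b} ha hb => by
        simpa only [Set.mem_ofPred_eq, linearForm_add] using A.ideal.add_mem ha hb
      smul_mem' := fun c a ha => by
        simpa only [Set.mem_ofPred_eq, linearForm_smul] using A.ideal.mul_mem_left _ ha }
  -- The tangent direction: a vector annihilated by all linear forms in the ideal, but not by `z`,
  -- which vanishes at `O`.
  obtain ⟨u, hu, hzu⟩ := exists_dotProduct_ne_zero I₁ (fun _ : Unit => z) fun _ => hz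
  specialize hzu ()
  rw [dotProduct_comm] at hzu
  have hind : LinearIndependent K ![O.rep, u] := by
    rw [LinearIndependent.pair_iff]
    intro s t hst
    have h1 := congrArg (z ⬝ᵥ ·) hst
    simp only [dotProduct_add, dotProduct_smul, hzO, smul_eq_mul, mul_zero, zero_add,
      dotProduct_zero] at h1
    have ht : t = 0 := (mul_eq_zero.mp h1).resolve_right hzu
    rw [ht, zero_smul, add_zero] at hst
    exact ⟨(smul_eq_zero.mp hst).resolve_right O.rep_nonzero, ht⟩
  have heval_u : ∀ a, linearForm a ∈ A.ideal → a ⬝ᵥ u = 0 := fun a ha => by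
    rw [dotProduct_comm]; exact hu a ha
  obtain ⟨x, hx⟩ := exists_dotProduct_eq_of_linearIndependent hind ![1, 0]
  obtain ⟨y, hy⟩ := exists_dotProduct_eq_of_linearIndependent hind ![0, 1]
  have hxO : x ⬝ᵥ O.rep = 1 := hx 0
  have hxu : x ⬝ᵥ u = 0 := hx 1
  have hyO : y ⬝ᵥ O.rep = 0 := hy 0
  have hyu : y ⬝ᵥ u = 1 := hy 1
  have hxO' : x ⬝ᵥ O.rep ≠ 0 := by rw [hxO]; exact one_ne_zero
  have hyA : linearForm y ∉ A.ideal := fun h => one_ne_zero (hyu.symm.trans (heval_u y h))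
  have hlin : ∀ a, a ⬝ᵥ O.rep = 0 → a ⬝ᵥ u = 0 → linearForm a ∈ A.ideal := by
    intro a haO hau
    obtain ⟨c, hc, hmem⟩ := hA.exists_relation hO ![linearForm x, linearForm y, linearForm a]
      (n := 1) (by intro i; fin_cases i <;> exact isHomogeneous_linearForm _)
    have hmem' : linearForm (c 0 • x + c 1 • y + c 2 • a) ∈ A.ideal := by
      simpa [Fin.sum_univ_three, linearForm_add, linearForm_smul] using hmem
    have h0 := heval _ hmem'
    have h1 := heval_u _ hmem'
    simp only [eval_linearForm, add_dotProduct, smul_dotProduct, hxO, hyO, haO, hxu, hyu, hau,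
      smul_eq_mul, mul_zero, mul_one, add_zero, zero_add] at h0 h1
    rw [h0, h1, zero_smul, zero_smul, zero_add, zero_add, linearForm_smul] at hmem'
    have h2 : c 2 ≠ 0 := fun h2 => hc (by ext i; fin_cases i <;> assumption)
    have h3 := A.ideal.mul_mem_left (C (c 2)⁻¹) hmem'
    rwa [← mul_assoc, ← C_mul, inv_mul_cancel₀ h2, C_1, one_mul] at h3
  -- In a relation between `x²`, `xy`, `y²`, evaluation at `O` removes `x²`. If `xy` occurred, a
  -- linear form nonzero at `O` could be cancelled, putting `y` in the ideal.
  have hsq : linearForm y ^ 2 ∈ A.ideal := by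
    obtain ⟨c, hc, hmem⟩ := hA.exists_relation hO
      ![linearForm x * linearForm x, linearForm x * linearForm y, linearForm y * linearForm y]
      (n := 2) (by
        intro i
        fin_cases i <;> exact (isHomogeneous_linearForm _).mul (isHomogeneous_linearForm _))
    simp only [Fin.sum_univ_three, Matrix.cons_val_zero, Matrix.cons_val_one,
      Matrix.cons_val_two, Matrix.head_cons, Matrix.tail_cons] at hmem
    have h0 := heval _ hmem
    simp only [map_add, map_mul, eval_C, eval_linearForm, hxO, hyO, mul_zero, mul_one,
      add_zero] at h0
    have hmem' : linearForm (c 1 • x + c 2 • y) * linearForm y ∈ A.ideal := by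
      convert hmem using 1
      rw [h0, linearForm_add, linearForm_smul, linearForm_smul, C_0]
      ring
    have h1 : c 1 = 0 := by
      by_contra h1
      refine hyA (mem_ideal_of_linearForm_mul_mem hO ?_ hmem')
      simpa [add_dotProduct, hxO, hyO] using h1
    rw [h1, zero_smul, zero_add, linearForm_smul] at hmem'
    have h2 : c 2 ≠ 0 := fun h2 => hc (by ext i; fin_cases i <;> assumption)
    have h3 := A.ideal.mul_mem_left (C (c 2)⁻¹) hmem'
    rwa [← mul_assoc, ← mul_assoc, ← C_mul, inv_mul_cancel₀ h2, C_1, one_mul, ← sq] at h3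
  let φ := Ideal.Quotient.mk A.ideal
  have hφ : ∀ f, φ f = 0 ↔ f ∈ A.ideal := fun f => Ideal.Quotient.eq_zero_iff_mem
  have hsq' : φ (linearForm y) ^ 2 = 0 := by rw [← map_pow]; exact (hφ _).mpr hsq
  have hφlin : ∀ a, φ (linearForm a) =
      φ (C (a ⬝ᵥ O.rep)) * φ (linearForm x) + φ (C (a ⬝ᵥ u)) * φ (linearForm y) := by
    intro a
    have h1 := (hφ _).mpr (hlin (a + ((-(a ⬝ᵥ O.rep)) • x + (-(a ⬝ᵥ u)) • y))
      (by simp [add_dotProduct, hxO, hyO]) (by simp [add_dotProduct, hxu, hyu]))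
    simp only [linearForm_add, linearForm_smul, map_add, map_mul, map_neg] at h1
    linear_combination h1
  -- First-order Taylor expansion modulo the ideal, by `y² = 0`. The extra factor `x` avoids the
  -- exponent `n - 1` and can be cancelled later.
  have hexp : ∀ n (f : MvPolynomial (Fin (m + 1)) K), f.IsHomogeneous n →
      φ (linearForm x) * φ f = φ (C (eval O.rep f)) * φ (linearForm x) ^ (n + 1) +
        φ (C (dirDeriv O.rep u f)) * φ (linearForm x) ^ n * φ (linearForm y) := by
    intro n f hf
    refine hf.induction_on (P := fun n f =>
      φ (linearForm x) * φ f = φ (C (eval O.rep f)) * φ (linearForm x) ^ (n + 1) +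
        φ (C (dirDeriv O.rep u f)) * φ (linearForm x) ^ n * φ (linearForm y)) ?_ ?_ ?_
    · intro r
      simp [dirDeriv_C, mul_comm]
    · intro n f g hf hg
      simp only [map_add, mul_add, hf, hg]
      ring
    · intro n a f hf
      rw [map_mul, mul_left_comm, hf, hφlin a]
      simp only [dirDeriv_mul, dirDeriv_linearForm, map_mul, map_add, eval_linearForm]
      linear_combination (φ (C (a ⬝ᵥ u)) * φ (C (dirDeriv O.rep u f)) * φ (linearForm x) ^ n) * hsq'
  refine ⟨u, hind, fun n f hf => ⟨fun hfA => ?_, fun ⟨h0, h1⟩ => ?_⟩⟩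
  · have h0 := heval f hfA
    refine ⟨h0, ?_⟩
    by_contra h1
    have h2 := hexp n f hf
    rw [(hφ f).mpr hfA, h0, C_0, map_zero, zero_mul, zero_add, mul_zero] at h2
    refine hyA (mem_ideal_of_linearForm_pow_mul_mem hO hxO' n ?_)
    rw [← hφ, map_mul, map_pow]
    have h3 : φ (C (dirDeriv O.rep u f)⁻¹) * φ (C (dirDeriv O.rep u f)) = 1 := by
      rw [← map_mul, ← C_mul, inv_mul_cancel₀ h1, C_1, map_one]
    linear_combination (-φ (C (dirDeriv O.rep u f)⁻¹)) * h2 -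
      (φ (linearForm x) ^ n * φ (linearForm y)) * h3
  · refine mem_ideal_of_linearForm_mul_mem hO hxO' ?_
    rw [← hφ, map_mul, hexp n f hf, h0, h1]
    simp

end ProjSubscheme

end DoublePoint

/-! ### From points spanning `P` to relations, and the count of `B`. -/

section Decomposition

variable {K : Type*} [Field K] {m : ℕ}

theorem Submodule.rep_mem_of_mem_projectivization {V : Type*} [AddCommGroup V] [Module K V]
    {W : Submodule K V} {P : ℙ K V} : P ∈ W.projectivization ↔ P.rep ∈ W := by
  conv_lhs => rw [← P.mk_rep]
  exact W.mk_mem_projectivization_iff P.rep_nonzero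

theorem veronese_eq_mk (d : ℕ) (q : ℙ K (Fin (m + 1) → K)) :
    veronese d q = Projectivization.mk K (evalForms d q.rep) (evalForms_ne_zero d q.rep_nonzero) := by
  conv_lhs => rw [← q.mk_rep]
  rfl

variable {d : ℕ} {P : ℙ K (VeroneseSpace K m d)} {B : Finset (ℙ K (Fin (m + 1) → K))}

theorem InVeroneseSpan.exists_sum_eq (h : InVeroneseSpan P B) :
    ∃ l : ℙ K (Fin (m + 1) → K) → K, ∀ f : homogeneousSubmodule (Fin (m + 1)) K d,
      P.rep f = ∑ q ∈ B, l q * eval q.rep (f : MvPolynomial (Fin (m + 1)) K) := by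
  classical
  have h1 := (Projectivization.Subspace.mem_span P).mp h
    (Submodule.span K (Set.range fun q : B => evalForms d q.1.rep)).projectivization (by
      rintro _ ⟨q, hq, rfl⟩
      rw [veronese_eq_mk]
      exact Submodule.subset_span ⟨⟨q, hq⟩, rfl⟩)
  rw [Submodule.rep_mem_of_mem_projectivization, Submodule.mem_span_range_iff_exists_fun] at h1
  obtain ⟨l, hl⟩ := h1
  refine ⟨fun q => if hq : q ∈ B then l ⟨q, hq⟩ else 0, fun f => ?_⟩
  rw [← hl, LinearMap.sum_apply, ← Finset.sum_coe_sort B]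
  exact Finset.sum_congr rfl fun q _ => by simp [evalForms_apply]

theorem inVeroneseSpan_of_forall (h : ∀ f : homogeneousSubmodule (Fin (m + 1)) K d,
    (∀ q ∈ B, VanishesAt (f : MvPolynomial (Fin (m + 1)) K) q) → P.rep f = 0) :
    InVeroneseSpan P B := by
  have h1 : P.rep ∈ Submodule.span K (Set.range fun q : B => evalForms d q.1.rep) := by
    refine mem_span_of_iInf_ker_le_ker fun f hf => ?_
    rw [Submodule.mem_iInf] at hf
    refine h f fun q hq => VanishesAt.of_rep f.2 ?_
    rw [← evalForms_apply]
    exact hf ⟨q, hq⟩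
  refine (Projectivization.Subspace.mem_span P).mpr fun W hW => ?_
  have h2 : Submodule.span K (Set.range fun q : B => evalForms d q.1.rep) ≤
      Projectivization.Subspace.submodule W := by
    rw [Submodule.span_le]
    rintro _ ⟨q, rfl⟩
    refine (Projectivization.Subspace.mem_submodule_iff W
      (evalForms_ne_zero d q.1.rep_nonzero)).mpr ?_
    rw [← veronese_eq_mk]
    exact hW ⟨q.1, q.2, rfl⟩
  have h3 := (Projectivization.Subspace.mem_submodule_iff W P.rep_nonzero).mp (h2 h1)
  rwa [P.mk_rep] at h3

theorem tangentFrame_linearIndependent_of_subset {O : ℙ K (Fin (m + 1) → K)}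
    {u : Fin (m + 1) → K} {S S' : Finset (ℙ K (Fin (m + 1) → K))}
    (hind : LinearIndependent K (tangentFrame O u S)) (hS : S' ⊆ S) :
    LinearIndependent K (tangentFrame O u S') := by
  have h : tangentFrame O u S' =
      tangentFrame O u S ∘ Sum.map id fun p => (⟨p.1, hS p.2⟩ : S) := by
    ext (i | p) j <;> rfl
  rw [h]
  exact hind.comp _ (Function.injective_id.sumMap fun p q hpq =>
    Subtype.ext (congrArg (fun x : S => x.1) hpq))

variable {O : ℙ K (Fin (m + 1) → K)} {u : Fin (m + 1) → K}
  {S T : Finset (ℙ K (Fin (m + 1) → K))} {b a : K} {c l : ℙ K (Fin (m + 1) → K) → K}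

/-- Cancelling the points common to both sides of a relation. -/
theorem TangentRelation.cancel [DecidableEq K] [DecidableEq (ℙ K (Fin (m + 1) → K))]
    (hO : O ∉ S) (h : TangentRelation d O u S B b a c l) :
    TangentRelation d O u (S.filter fun p => c p - (if p ∈ B then l p else 0) ≠ 0)
      ((B \ insert O S).filter fun q => l q ≠ 0) b (a - if O ∈ B then l O else 0)
      (fun p => c p - if p ∈ B then l p else 0) l := by
  intro f hf
  have h1 := h f hf
  rw [Finset.sum_filter_of_ne (by intro p _ hp h0; exact hp (by simp only [h0, zero_mul])),
    Finset.sum_filter_of_ne (by intro p _ hp h0; exact hp (by simp only [h0, zero_mul]))]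
  have h2 : ∑ q ∈ B, l q * eval q.rep f = ∑ q ∈ B \ insert O S, l q * eval q.rep f +
      ((if O ∈ B then l O else 0) * eval O.rep f +
        ∑ p ∈ S, (if p ∈ B then l p else 0) * eval p.rep f) := by
    rw [← Finset.sum_insert (f := fun p => (if p ∈ B then l p else 0) * eval p.rep f) hO,
      ← Finset.sum_inter_add_sum_sdiff B (insert O S), add_comm, Finset.inter_comm]
    congr 1
    rw [← Finset.filter_mem_eq_inter, Finset.sum_filter]
    exact Finset.sum_congr rfl fun p _ => by split_ifs <;> simp
  rw [h2] at h1
  simp only [sub_mul, Finset.sum_sub_distrib]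
  linear_combination h1

/-- Adds degree one to `card_add_le`: there `S` is empty, and `T` is nonempty because the derivative
is not a multiple of the evaluation at `O`. -/
theorem TangentRelation.card_add_le_of_pos [Infinite K]
    (hind : LinearIndependent K (tangentFrame O u S)) (h : TangentRelation d O u S T b a c l)
    (hb : b ≠ 0) (hc : ∀ p ∈ S, c p ≠ 0) (hO : O ∉ T) (hST : Disjoint S T) (hd : 0 < d)
    (hS : d = 1 → S = ∅) : S.card + d ≤ T.card := by
  obtain rfl | ⟨n, rfl⟩ : d = 1 ∨ ∃ n, d = n + 2 := by
    rcases d with _ | _ | n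
    · omega
    · exact Or.inl rfl
    · exact Or.inr ⟨n, rfl⟩
  · rw [hS rfl, Finset.card_empty, zero_add, Nat.one_le_iff_ne_zero, Finset.card_ne_zero,
      Finset.nonempty_iff_ne_empty]
    rintro rfl
    obtain ⟨x, hxO, hxu, hxS⟩ := exists_dotProduct_eq_of_tangentFrame hind 0 1 fun _ => 0
    have h1 := h _ (isHomogeneous_linearForm x)
    simp [hS rfl, dirDeriv_linearForm, eval_linearForm, hxO, hxu, hb] at h1
  · exact h.card_add_le hind hb hc hO hST

/-- The points in a decomposition of the sum of a tangent vector and of the points of `S`. -/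
theorem TangentRelation.le_card_and_eq [Infinite K]
    (hind : LinearIndependent K (tangentFrame O u S)) (hOS : O ∉ S)
    (h : TangentRelation d O u S B b a c l) (hb : b ≠ 0) (hc : ∀ p ∈ S, c p ≠ 0)
    (hd : S.card + 1 ≤ d) :
    S.card + d ≤ B.card ∧ (¬ (d = 2 ∧ S.card = 1) → B.card = S.card + d →
      ∃ E : Finset (ℙ K (Fin (m + 1) → K)), Disjoint S E ∧
        (B : Set (ℙ K (Fin (m + 1) → K))) = (S : Set (ℙ K (Fin (m + 1) → K))) ∪ E ∧ E.card = d ∧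
        ∀ q ∈ E, q.rep ∈ Submodule.span K {O.rep, u} ∧ q ≠ O) := by
  classical
  have hrel := h.cancel hOS
  set T := (B \ insert O S).filter fun q => l q ≠ 0 with hT
  set S' := S.filter fun p => c p - (if p ∈ B then l p else 0) ≠ 0 with hS'
  have hS'S : S' ⊆ S := Finset.filter_subset _ _
  have hind' := tangentFrame_linearIndependent_of_subset hind hS'S
  have hc' : ∀ p ∈ S', c p - (if p ∈ B then l p else 0) ≠ 0 := fun p hp =>
    (Finset.mem_filter.mp hp).2
  have hTB : T ⊆ B \ insert O S := Finset.filter_subset _ _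
  have hTO : O ∉ T := fun hO => (Finset.mem_sdiff.mp (hTB hO)).2 (Finset.mem_insert_self _ _)
  have hdisj : Disjoint S T := Finset.disjoint_left.mpr fun p hp hpT =>
    (Finset.mem_sdiff.mp (hTB hpT)).2 (Finset.mem_insert_of_mem hp)
  have hdisj' : Disjoint S' T := hdisj.mono_left hS'S
  have h1 := hrel.card_add_le_of_pos hind' hb hc' hTO hdisj' (by omega) fun hd1 =>
    Finset.card_eq_zero.mp (by have := Finset.card_le_card hS'S; omega)
  -- A point leaves `S` only by cancelling its nonzero coefficient, so it belongs to `B`.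
  have hsub : (S \ S') ∪ T ⊆ B := by
    refine Finset.union_subset (fun p hp => ?_) fun q hq => (Finset.mem_sdiff.mp (hTB hq)).1
    rw [Finset.mem_sdiff, hS', Finset.mem_filter, not_and, not_not] at hp
    by_contra hpB
    have h2 := hp.2 hp.1
    rw [if_neg hpB, sub_zero] at h2
    exact hc p hp.1 h2
  have hunion : ((S \ S') ∪ T).card = S.card - S'.card + T.card := by
    rw [Finset.card_union_of_disjoint (hdisj.mono_left Finset.sdiff_subset),
      Finset.card_sdiff_of_subset hS'S]
  have hle := Finset.card_le_card hsub
  have hS'card := Finset.card_le_card hS'S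
  refine ⟨by omega, fun hexc hB => ?_⟩
  have hTcard : T.card = S'.card + d := by omega
  have hBeq : (S \ S') ∪ T = B := Finset.eq_of_subset_of_card_le hsub (by omega)
  have hempty : S' = ∅ := by
    by_contra hne
    have hne' := Finset.nonempty_iff_ne_empty.mpr hne
    have hpos := hne'.card_pos
    -- Since `S` is nonempty, `d ≥ |S| + 1 ≥ 2`, and `d = 2` would force the excluded case `|S| =
    -- 1`.
    obtain ⟨n, rfl⟩ : ∃ n, d = n + 3 := ⟨d - 3, by omega⟩
    have := hrel.card_add_lt hind' hb hc' hTO hdisj' hne'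
    omega
  rw [hempty, Finset.card_empty, zero_add] at hTcard
  rw [hempty, Finset.sdiff_empty] at hBeq
  rw [hempty] at hrel
  refine ⟨T, hdisj, by rw [← hBeq, Finset.coe_union], hTcard, fun q hq => ⟨?_, fun e => hTO (e ▸ hq)⟩⟩
  obtain ⟨n, rfl⟩ : ∃ n, d = n + 1 := ⟨d - 1, by omega⟩
  exact hrel.mem_span_pair (fun q hq => (Finset.mem_filter.mp hq).2) hTcard.le hq

end Decomposition

/-! ### Translating the scheme hypotheses into coefficients and independence. -/

section TangentScheme

variable {K : Type*} [Field K] {m : ℕ}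

namespace ProjSubscheme

variable {A₁ : ProjSubscheme K m} {O : ℙ K (Fin (m + 1) → K)} {u : Fin (m + 1) → K}
  {S : Finset (ℙ K (Fin (m + 1) → K))}

theorem mem_ofFinset_iff [Infinite K] {f : MvPolynomial (Fin (m + 1)) K} :
    f ∈ (ofFinset S).ideal ↔ ∀ p ∈ S, VanishesAt f p := Iff.rfl

/-- Forms through the union of a tangent vector and a finite set of points. -/
theorem mem_union_ofFinset_iff [Infinite K]
    (hA₁ : ∀ (n : ℕ) (f : MvPolynomial (Fin (m + 1)) K), f.IsHomogeneous n →
      (f ∈ A₁.ideal ↔ eval O.rep f = 0 ∧ dirDeriv O.rep u f = 0))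
    {n : ℕ} {f : MvPolynomial (Fin (m + 1)) K} (hf : f.IsHomogeneous n) :
    f ∈ (A₁.union (ofFinset S)).ideal ↔
      (eval O.rep f = 0 ∧ dirDeriv O.rep u f = 0) ∧ ∀ p ∈ S, eval p.rep f = 0 :=
  and_congr (hA₁ n f hf) (forall₂_congr fun _ _ => ⟨VanishesAt.eval_rep, VanishesAt.of_rep hf⟩)

theorem formsThrough_union_ofFinset [Infinite K]
    (hA₁ : ∀ (n : ℕ) (f : MvPolynomial (Fin (m + 1)) K), f.IsHomogeneous n →
      (f ∈ A₁.ideal ↔ eval O.rep f = 0 ∧ dirDeriv O.rep u f = 0)) (n : ℕ) :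
    (A₁.union (ofFinset S)).formsThrough n = LinearMap.ker (jetEval n O u S) := by
  ext f
  rw [mem_formsThrough, mem_union_ofFinset_iff hA₁ f.2, LinearMap.mem_ker]
  constructor
  · rintro ⟨⟨h0, h1⟩, h2⟩
    ext (i | p)
    · fin_cases i
      · exact h1
      · exact (jetEval_inl_one f).trans h0
    · exact (jetEval_inr f p).trans (h2 p p.2)
  · intro h
    exact ⟨⟨(jetEval_inl_one f).symm.trans (congrFun h _), congrFun h (Sum.inl 0)⟩,
      fun p hp => (jetEval_inr f ⟨p, hp⟩).symm.trans (congrFun h _)⟩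

/-- In large degree, surjectivity of `jetEval` gives the scheme degree `|S| + 2`; by hypothesis this
is the dimension of its linear span, which is contained in the span of the `|S| + 2` frame vectors.
-/
theorem IsLinearlyIndependent.tangentFrame [Infinite K]
    (hA₁ : ∀ (n : ℕ) (f : MvPolynomial (Fin (m + 1)) K), f.IsHomogeneous n →
      (f ∈ A₁.ideal ↔ eval O.rep f = 0 ∧ dirDeriv O.rep u f = 0))
    (hu : LinearIndependent K ![O.rep, u]) (hO : O ∉ S)
    (hA : (A₁.union (ofFinset S)).IsLinearlyIndependent) :
    LinearIndependent K (tangentFrame O u S) := by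
  rw [linearIndependent_iff_card_le_finrank_span]
  obtain ⟨n, hn, hn'⟩ := (hA.and (Filter.eventually_ge_atTop (S.card + 1))).exists
  rw [formsThrough_union_ofFinset hA₁, (LinearMap.quotKerEquivOfSurjective _
    (jetEval_surjective hu hO hn')).finrank_eq, Module.finrank_fintype_fun_eq_card] at hn
  rw [hn]
  refine Submodule.finrank_mono fun v hv => ?_
  by_contra hne
  obtain ⟨x, hx, hxv⟩ := exists_dotProduct_ne_zero _ (fun _ : Unit => v) fun _ => hne
  have hx' : ∀ i, x ⬝ᵥ _root_.tangentFrame O u S i = 0 := fun i =>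
    hx _ (Submodule.subset_span ⟨i, rfl⟩)
  refine hxv () (hv x ((mem_union_ofFinset_iff hA₁ (isHomogeneous_linearForm x)).mpr
    ⟨⟨?_, ?_⟩, fun p hp => ?_⟩))
  · rw [eval_linearForm]; exact hx' (Sum.inl 0)
  · rw [dirDeriv_linearForm]; exact hx' (Sum.inl 1)
  · rw [eval_linearForm]; exact hx' (Sum.inr ⟨p, hp⟩)

theorem mem_linearSpan_of_mem_span_pair
    (hA₁ : ∀ (n : ℕ) (f : MvPolynomial (Fin (m + 1)) K), f.IsHomogeneous n →
      (f ∈ A₁.ideal ↔ eval O.rep f = 0 ∧ dirDeriv O.rep u f = 0))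
    {v : Fin (m + 1) → K} (hv : v ∈ Submodule.span K {O.rep, u}) : v ∈ A₁.linearSpan := by
  refine (Submodule.span_le (p := A₁.linearSpan)).mpr ?_ hv
  rintro w (rfl | rfl) x hx
  · rw [← eval_linearForm]; exact ((hA₁ 1 _ (isHomogeneous_linearForm x)).mp hx).1
  · rw [← dirDeriv_linearForm O.rep]; exact ((hA₁ 1 _ (isHomogeneous_linearForm x)).mp hx).2

variable {d : ℕ} {P : ℙ K (VeroneseSpace K m d)}

theorem mem_veroneseSpan_iff {A : ProjSubscheme K m} :
    P ∈ A.veroneseSpan d ↔ ∀ f ∈ A.formsThrough d, P.rep f = 0 := by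
  rw [veroneseSpan, Submodule.rep_mem_of_mem_projectivization, Submodule.mem_dualAnnihilator]

/-- A point in the span of the union of a tangent vector and a finite set of points. -/
theorem exists_sum_eq_of_mem_veroneseSpan [Infinite K]
    (hA₁ : ∀ (n : ℕ) (f : MvPolynomial (Fin (m + 1)) K), f.IsHomogeneous n →
      (f ∈ A₁.ideal ↔ eval O.rep f = 0 ∧ dirDeriv O.rep u f = 0))
    (hP : P ∈ (A₁.union (ofFinset S)).veroneseSpan d) :
    ∃ (b a : K) (c : ℙ K (Fin (m + 1) → K) → K),
      ∀ f : homogeneousSubmodule (Fin (m + 1)) K d, P.rep f =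
        b * dirDeriv O.rep u f + a * eval O.rep (f : MvPolynomial (Fin (m + 1)) K) +
          ∑ p ∈ S, c p * eval p.rep (f : MvPolynomial (Fin (m + 1)) K) := by
  classical
  have h : P.rep ∈ LinearMap.range (jetEval d O u S).dualMap := by
    rw [LinearMap.range_dualMap_eq_dualAnnihilator_ker, ← formsThrough_union_ofFinset hA₁,
      Submodule.mem_dualAnnihilator]
    exact mem_veroneseSpan_iff.mp hP
  obtain ⟨g, hg⟩ := h
  refine ⟨g (Pi.single (Sum.inl 0) 1), g (Pi.single (Sum.inl 1) 1),
    fun p => if hp : p ∈ S then g (Pi.single (Sum.inr ⟨p, hp⟩) 1) else 0, fun f => ?_⟩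
  have h1 : ∀ w : Fin 2 ⊕ S → K, g w = ∑ i, w i * g (Pi.single i 1) := by
    intro w
    conv_lhs => rw [pi_eq_sum_univ' w]
    simp only [map_sum, map_smul, smul_eq_mul]
  rw [← hg, LinearMap.dualMap_apply, h1, Fintype.sum_sum_type, Fin.sum_univ_two,
    jetEval_inl_zero, jetEval_inl_one, ← Finset.sum_coe_sort S]
  congr 1
  · ring
  · exact Finset.sum_congr rfl fun p _ => by simp [jetEval_inr, mul_comm]

/-- If `b = 0`, the reduced scheme `S ∪ {O}` already spans `P`; if `c p = 0`, the point `p` can be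
dropped. Linear forms dual to the frame show that both subschemes are proper. -/
theorem ne_zero_of_minimal [Infinite K] (hO : O ∈ A₁.support)
    (hA₁ : ∀ (n : ℕ) (f : MvPolynomial (Fin (m + 1)) K), f.IsHomogeneous n →
      (f ∈ A₁.ideal ↔ eval O.rep f = 0 ∧ dirDeriv O.rep u f = 0))
    (hind : LinearIndependent K (_root_.tangentFrame O u S))
    (hmin : ∀ A' : ProjSubscheme K m, A' < A₁.union (ofFinset S) → P ∉ A'.veroneseSpan d)
    {b a : K} {c : ℙ K (Fin (m + 1) → K) → K}
    (hP : ∀ f : homogeneousSubmodule (Fin (m + 1)) K d, P.rep f =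
        b * dirDeriv O.rep u f + a * eval O.rep (f : MvPolynomial (Fin (m + 1)) K) +
          ∑ p ∈ S, c p * eval p.rep (f : MvPolynomial (Fin (m + 1)) K)) :
    b ≠ 0 ∧ ∀ p ∈ S, c p ≠ 0 := by
  classical
  refine ⟨fun hb => ?_, fun p hp hc => ?_⟩
  · refine hmin (ofFinset (insert O S)) (lt_of_le_not_ge ?_ ?_) ?_
    · intro f hf p hp
      rcases Finset.mem_insert.mp hp with rfl | hp
      · exact hO f hf.1
      · exact hf.2 p hp
    · intro hle
      obtain ⟨x, hxO, hxu, hxS⟩ := exists_dotProduct_eq_of_tangentFrame hind 0 1 fun _ => 0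
      have h1 : linearForm x ∈ (ofFinset (insert O S)).ideal := by
        intro p hp
        refine VanishesAt.of_rep (isHomogeneous_linearForm x) ?_
        rw [eval_linearForm]
        rcases Finset.mem_insert.mp hp with rfl | hp
        · exact hxO
        · exact hxS p hp
      have h2 := ((mem_union_ofFinset_iff hA₁ (isHomogeneous_linearForm x)).mp (hle h1)).1.2
      rw [dirDeriv_linearForm, hxu] at h2
      exact one_ne_zero h2
    · rw [mem_veroneseSpan_iff]
      intro f hf
      have hf' : ∀ p ∈ insert O S, eval p.rep (f : MvPolynomial (Fin (m + 1)) K) = 0 :=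
        fun p hp => VanishesAt.eval_rep (mem_ofFinset_iff.mp hf p hp)
      rw [hP, hb, hf' O (Finset.mem_insert_self _ _), Finset.sum_eq_zero fun p hp => by
        rw [hf' p (Finset.mem_insert_of_mem hp), mul_zero]]
      simp
  · refine hmin (A₁.union (ofFinset (S.erase p))) (lt_of_le_not_ge ?_ ?_) ?_
    · exact fun f hf => ⟨hf.1, fun q hq => hf.2 q (Finset.mem_of_mem_erase hq)⟩
    · intro hle
      obtain ⟨x, hxO, hxu, hxS⟩ := exists_dotProduct_eq_of_tangentFrame hind 0 0
        fun q => if q = p then 1 else 0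
      have h1 : linearForm x ∈ (A₁.union (ofFinset (S.erase p))).ideal := by
        refine (mem_union_ofFinset_iff hA₁ (isHomogeneous_linearForm x)).mpr
          ⟨⟨?_, ?_⟩, fun q hq => ?_⟩
        · rw [eval_linearForm, hxO]
        · rw [dirDeriv_linearForm, hxu]
        · rw [eval_linearForm, hxS q (Finset.mem_of_mem_erase hq),
            if_neg (Finset.ne_of_mem_erase hq)]
      have h2 := ((mem_union_ofFinset_iff hA₁ (isHomogeneous_linearForm x)).mp (hle h1)).2 p hp
      rw [eval_linearForm, hxS p hp, if_pos rfl] at h2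
      exact one_ne_zero h2
    · rw [mem_veroneseSpan_iff]
      intro f hf
      obtain ⟨⟨h0, h1⟩, h2⟩ := (mem_union_ofFinset_iff hA₁ f.2).mp (mem_formsThrough f |>.mp hf)
      rw [hP, h0, h1, Finset.sum_eq_zero fun q hq => ?_]
      · simp
      · by_cases hqp : q = p
        · rw [hqp, hc, zero_mul]
        · rw [h2 q (Finset.mem_erase.mpr ⟨hqp, hq⟩), mul_zero]

end ProjSubscheme

end TangentScheme

end

/-! ### The rank and the sets that evince it. -/

theorem mainTheorem2 {K : Type*} [Field K] [IsAlgClosed K] [CharZero K]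
    (m d s : ℕ) (hs : s + 1 ≤ m) (hd : m ≤ d)
    -- a connected zero-dimensional scheme `A₁` of degree `2`, with reduction `{O}`
    (A₁ : ProjSubscheme K m) (hA₁ : A₁.HasDegree 2)
    (O : ℙ K (Fin (m + 1) → K)) (hO : A₁.support = {O})
    -- a set `S` of `s` points, disjoint from `A₁`
    (S : Finset (ℙ K (Fin (m + 1) → K))) (hScard : S.card = s)
    (hSA₁ : Disjoint (S : Set (ℙ K (Fin (m + 1) → K))) A₁.support)
    -- `A = A₁ ∪ S` is linearly independent
    (A : ProjSubscheme K m) (hA : A = A₁.union (ProjSubscheme.ofFinset S))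
    (hAind : A.IsLinearlyIndependent)
    -- `P ∈ ⟨ν_d(A)⟩` lies in the span of no proper subscheme
    (P : ℙ K (VeroneseSpace K m d)) (hP : P ∈ A.veroneseSpan d)
    (hPmin : ∀ A' : ProjSubscheme K m, A' < A → P ∉ A'.veroneseSpan d) :
    symRank P = s + d ∧
      (¬ (d = 2 ∧ s = 1) → ∀ B ∈ rankSets P, ∃ E : Finset (ℙ K (Fin (m + 1) → K)),
        Disjoint S E ∧
        (B : Set (ℙ K (Fin (m + 1) → K))) = (S : Set (ℙ K (Fin (m + 1) → K))) ∪ E ∧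
        E.card = d ∧
        ∀ p ∈ E, p ∈ A₁.linearSpan.projectivization ∧ p ≠ O) := by
  classical
  subst hA
  subst hScard
  have hOS : O ∉ S := fun h => Set.disjoint_left.mp hSA₁ h (hO ▸ Set.mem_singleton O)
  obtain ⟨u, hu, htan⟩ := hA₁.exists_tangent hO
  have hind := ProjSubscheme.IsLinearlyIndependent.tangentFrame htan hu hOS hAind
  obtain ⟨b, a, c, hrep⟩ := ProjSubscheme.exists_sum_eq_of_mem_veroneseSpan htan hP
  obtain ⟨hb, hc⟩ := ProjSubscheme.ne_zero_of_minimal (hO ▸ Set.mem_singleton O) htan hind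
    hPmin hrep
  have hdec : ∀ B : Finset (ℙ K (Fin (m + 1) → K)), InVeroneseSpan P B →
      ∃ l, TangentRelation d O u S B b a c l := by
    intro B hB
    obtain ⟨l, hl⟩ := hB.exists_sum_eq
    refine ⟨l, fun f hf => ?_⟩
    let F : MvPolynomial.homogeneousSubmodule (Fin (m + 1)) K d := ⟨f, hf⟩
    exact (hrep F).symm.trans (hl F)
  have hrank : symRank P = S.card + d := by
    obtain ⟨E, hE, hEf⟩ := exists_finset_tangent_eq_zero (a := a) hu hb (show 0 < d by omega)
    have hmem : InVeroneseSpan P (S ∪ E) := by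
      refine inVeroneseSpan_of_forall fun f hf => ?_
      rw [hrep, hEf f f.2 fun p hp => hf p (Finset.mem_union_right _ hp),
        Finset.sum_eq_zero fun p hp => by
          rw [(hf p (Finset.mem_union_left _ hp)).eval_rep, mul_zero], zero_add]
    have hset : (S ∪ E).card ∈ {n | ∃ B : Finset (ℙ K (Fin (m + 1) → K)),
        B.card = n ∧ InVeroneseSpan P B} := ⟨S ∪ E, rfl, hmem⟩
    refine le_antisymm ((Nat.sInf_le hset).trans ?_) ?_
    · exact (Finset.card_union_le _ _).trans (by omega)
    · refine le_csInf ⟨_, hset⟩ ?_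
      rintro _ ⟨B, rfl, hB⟩
      obtain ⟨l, hl⟩ := hdec B hB
      exact (hl.le_card_and_eq hind hOS hb hc (by omega)).1
  refine ⟨hrank, fun hexc B hB => ?_⟩
  obtain ⟨l, hl⟩ := hdec B hB.1
  obtain ⟨E, hE, hBE, hEcard, hEO⟩ := (hl.le_card_and_eq hind hOS hb hc (by omega)).2 hexc
    (hB.2.trans hrank)
  exact ⟨E, hE, hBE, hEcard, fun p hp => ⟨Submodule.rep_mem_of_mem_projectivization.mpr
    (ProjSubscheme.mem_linearSpan_of_mem_span_pair htan (hEO p hp).1), (hEO p hp).2⟩⟩
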